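/- Let $m\ge 3$ be an integer. By an $m$-gon $\mathcal M$ we mean a simple closed polygonal curve in the Euclidean plane $\mathbb R^2$ with $m$ vertices (not necessarily convex), joined cyclically by $m$ straight edges; simple means that the closed curve does not pass through any point twice. Let $\mathsf A(\mathcal M)$ denote the area of the region enclosed by $\mathcal M$ (the curve together with the bounded part of its complement), and let $\mathsf S(\mathcal M)$ denote half the perimeter of $\mathcal M$. Call $\mathcal M$ a unit $m$-gon if $\mathsf A(\mathcal M)=\mathsf S(\mathcal M)$. The fundamental measure $\Pi_{\mathcal M}$ of a unit $m$-gon $\mathcal M$ is the area of its rescaling by the factor $\mathsf S(\mathcal M)/\mathsf A(\mathcal M)=1$, that is, $\Pi_{\mathcal M}=\mathsf A(\mathcal M)=\mathsf S(\mathcal M)$. Put $\rho_m:=m\tan(\pi/m)$, and let $\mathcal U^{(m\text{-reg})}$ be a regular $m$-gon with unit apothem, i.e. the distance from its center to each side equals $1$. Then every unit $m$-gon $\mathcal M$ satisfies $$\rho_m\le \Pi_{\mathcal M},$$ with equality if and only if $\mathcal M$ is congruent to $\mathcal U^{(m\text{-reg})}$, i.e. some isometry of the plane maps $\mathcal M$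 onto $\mathcal U^{(m\text{-reg})}$. -/

import Mathlib

noncomputable section

namespace UnitShapes

/-- The Euclidean plane. -/
abbrev Plane : Type := EuclideanSpace ℝ (Fin 2)

/-- The region enclosed by a curve (identified with its image `C`): the points of `C`, together
with the points of the complement that lie in a bounded connected component of it. -/
def enclosedRegion (C : Set Plane) : Set Plane :=
  C ∪ {x ∈ Cᶜ | Bornology.IsBounded (connectedComponentIn Cᶜ x)}

/-- The area of the enclosed region (Lebesgue measure). -/
def area (C : Set Plane) : ℝ :=
  MeasureTheory.volume.real (enclosedRegion C)

/-- Two plane curves are congruent if a rigid motion (a Euclidean isometry, possibly reversing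
the orientation) maps the image of the first onto the image of the second. -/
def AreCongruent (C D : Set Plane) : Prop :=
  ∃ f : Plane ≃ᵃⁱ[ℝ] Plane, f '' C = D

variable {m : ℕ}

/-- The closed polygonal line through the vertices of `M` is a simple closed curve: run through
edge by edge, with each edge parametrized by `[0, 1)`, it visits no point twice. In particular
consecutive vertices are distinct. Straight angles at vertices are allowed. -/
def IsSimple (M : Polygon Plane m) : Prop :=
  ∀ i j : Fin m, ∀ s ∈ Set.Ico (0 : ℝ) 1, ∀ t ∈ Set.Ico (0 : ℝ) 1,
    M.edgePath ℝ i s = M.edgePath ℝ j t → i = j ∧ s = t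

/-- The area enclosed by a polygon. -/
def polyArea (M : Polygon Plane m) : ℝ := area (M.boundary ℝ)

/-- The perimeter of a polygon: the sum of its side lengths. -/
def perimeter (M : Polygon Plane m) : ℝ :=
  ∑ i : Fin m, dist (M i) (M (finRotate m i))

/-- Half of the perimeter. -/
def semiperimeter (M : Polygon Plane m) : ℝ := perimeter M / 2

/-- A unit polygon: its area equals its semiperimeter. -/
def IsUnitPolygon (M : Polygon Plane m) : Prop :=
  polyArea M = semiperimeter M

/-- The image of a polygon under the scaling `x ↦ c • x` of the plane. -/
def scale (c : ℝ) (M : Polygon Plane m) : Polygon Plane m := ⟨fun i => c • M i⟩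

/-- The canonical unit polygon similar to `M`: `M` scaled by semiperimeter over area. -/
def canonicalUnit (M : Polygon Plane m) : Polygon Plane m :=
  scale (semiperimeter M / polyArea M) M

/-- The fundamental measure: the area of the canonical unit polygon similar to `M`. -/
def fundamentalMeasure (M : Polygon Plane m) : ℝ := polyArea (canonicalUnit M)

/-- The constant `m tan(π / m)`. -/
def rho (m : ℕ) : ℝ := m * Real.tan (Real.pi / m)

/-- The regular `m`-gon centred at the origin with unit apothem, that is, with circumradius
`1 / cos(π / m)`. -/
def regularPolygon (m : ℕ) : Polygon Plane m :=
  ⟨fun k => (1 / Real.cos (Real.pi / m)) •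
    !₂[Real.cos (2 * Real.pi * (k : ℕ) / m), Real.sin (2 * Real.pi * (k : ℕ) / m)]⟩

end UnitShapes

end

/-!
Expanding the vertices in a Fourier series gives a discrete Wirtinger inequality: the signed area of
a closed `m`-gon is at most its energy, the sum of its squared side lengths, divided by
`4 tan (π / m)`, with equality only for regular polygons. Moving a vertex parallel to the line
through its two neighbours until it is equidistant from them keeps the signed area, does not
increase the length and decreases the energy. Hence an `m`-gon of least energy, among those that
have at least the given area and at most the given length `L`, is equilateral, its energy is at most
`L ^ 2 / m`, and the isoperimetric inequality `4 ρ_m A ≤ L ^ 2` follows for signed areas `A`.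

It carries over to the convex hull of the vertices. A shortest tour through the extreme points of
the hull has all of them on one side of each of its edges, since otherwise a two-opt move would
shorten it. So it is a convex polygon, not longer than the original one, whose signed area is that
of the hull. The region enclosed by a polygon lies in the hull of its vertices, and for a unit
polygon, where `A = L / 2`, the inequality reads `ρ_m ≤ A`.

In the equality case the shortest tour is a regular `m`-gon, so the original polygon is a tour of
the same length through the same `m` points. As the sides of a regular polygon are its shortest
chords, the original polygon uses only sides and runs around the regular polygon once.
-/

noncomputable section

namespace UnitShapes

open Finset ComplexConjugate

attribute [local instance] Complex.finrank_real_complex_fact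

local notation "ω" => Orientation.areaForm Complex.orientation

theorem areaForm_eq (a b : ℂ) : ω a b = a.re * b.im - a.im * b.re := by
  rw [Complex.areaForm, Complex.mul_im, Complex.conj_re, Complex.conj_im]
  ring

theorem areaForm_sub_sub_rotate (a p q : ℂ) : ω (q - p) (a - p) = ω (p - a) (q - a) := by
  simp only [areaForm_eq, Complex.sub_re, Complex.sub_im]
  ring

/-- The signed area of the closed polygon with vertices `w k`, by the shoelace formula. -/
def signedArea {m : ℕ} [NeZero m] (w : ZMod m → ℂ) : ℝ := (∑ k, ω (w k) (w (k + 1))) / 2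

/-- The length of the closed polygon with vertices `w k`. -/
def closedLength {X : Type*} [PseudoMetricSpace X] {m : ℕ} [NeZero m] (w : ZMod m → X) : ℝ :=
  ∑ k, dist (w k) (w (k + 1))

/-- The sum of the squared side lengths of the closed polygon with vertices `w k`: the energy that
the discrete Wirtinger inequality compares with the signed area. -/
def closedEnergy {X : Type*} [PseudoMetricSpace X] {m : ℕ} [NeZero m] (w : ZMod m → X) : ℝ :=
  ∑ k, dist (w k) (w (k + 1)) ^ 2

/-! ### The discrete Wirtinger inequality -/

section Wirtinger

variable {m : ℕ}

theorem pi_div_pos (hm : 3 ≤ m) : 0 < Real.pi / m :=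
  div_pos Real.pi_pos (by positivity)

theorem pi_div_lt_pi_div_two (hm : 3 ≤ m) : Real.pi / m < Real.pi / 2 :=
  div_lt_div_of_pos_left Real.pi_pos two_pos (by exact_mod_cast hm)

theorem cos_pi_div_pos (hm : 3 ≤ m) : 0 < Real.cos (Real.pi / m) :=
  Real.cos_pos_of_mem_Ioo ⟨by linarith [pi_div_pos hm, Real.pi_pos], pi_div_lt_pi_div_two hm⟩

theorem tan_pi_div_pos (hm : 3 ≤ m) : 0 < Real.tan (Real.pi / m) :=
  Real.tan_pos_of_pos_of_lt_pi_div_two (pi_div_pos hm) (pi_div_lt_pi_div_two hm)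

variable [NeZero m]

open ZMod

theorem sin_pi_mul_val_div_pos {j : ZMod m} (hj : j ≠ 0) : 0 < Real.sin (Real.pi * j.val / m) := by
  have hm : (0 : ℝ) < m := by exact_mod_cast NeZero.pos m
  have hpos : (0 : ℝ) < j.val := by exact_mod_cast Nat.pos_of_ne_zero ((ZMod.val_ne_zero j).2 hj)
  have hlt : (j.val : ℝ) < m := by exact_mod_cast ZMod.val_lt j
  refine Real.sin_pos_of_pos_of_lt_pi (by positivity) ?_
  rw [div_lt_iff₀ hm]
  exact mul_lt_mul_of_pos_left hlt Real.pi_pos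

theorem stdAddChar_eq_exp (j : ZMod m) :
    (stdAddChar j : ℂ) = Complex.exp (Complex.I * (2 * (Real.pi * j.val / m) : ℝ)) := by
  rw [stdAddChar_apply, toCircle_apply]
  congr 1
  push_cast
  ring

theorem norm_stdAddChar_sub_one (j : ZMod m) :
    ‖(stdAddChar j : ℂ) - 1‖ = 2 * Real.sin (Real.pi * j.val / m) := by
  have hsin : 0 ≤ Real.sin (Real.pi * j.val / m) := by
    rcases eq_or_ne j 0 with rfl | hj
    · simp
    · exact (sin_pi_mul_val_div_pos hj).le
  rw [stdAddChar_eq_exp, Complex.norm_exp_I_mul_ofReal_sub_one, mul_div_cancel_left₀ _ two_ne_zero,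
    Real.norm_of_nonneg (by positivity)]

theorem stdAddChar_im (j : ZMod m) :
    (stdAddChar j : ℂ).im =
      2 * Real.sin (Real.pi * j.val / m) * Real.cos (Real.pi * j.val / m) := by
  rw [stdAddChar_eq_exp, mul_comm, Complex.exp_ofReal_mul_I_im, Real.sin_two_mul]

theorem sum_conj_dft_mul_dft (u v : ZMod m → ℂ) :
    ∑ j, conj (dft u j) * dft v j = m * ∑ k, conj (u k) * v k := by
  have inversion (k) : ∑ j, stdAddChar (j * k) * dft v j = m * v k := by
    have h := congrFun (dft.symm_apply_apply v) k
    rw [invDFT_apply, smul_eq_mul, inv_mul_eq_iff_eq_mul₀ (NeZero.ne (m : ℂ))] at h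
    simpa only [smul_eq_mul] using h
  calc ∑ j, conj (dft u j) * dft v j
      = ∑ j, ∑ k, conj (u k) * (stdAddChar (j * k) * dft v j) := by
        refine sum_congr rfl fun j _ => ?_
        rw [dft_apply, map_sum, sum_mul]
        refine sum_congr rfl fun k _ => ?_
        rw [smul_eq_mul, map_mul, AddChar.map_neg_eq_conj, Complex.conj_conj, mul_comm k j]
        ring
    _ = m * ∑ k, conj (u k) * v k := by
        simp only [sum_comm (γ := ZMod m), ← mul_sum, inversion, mul_left_comm _ (m : ℂ)]

theorem dft_comp_add_one (z : ZMod m → ℂ) (j : ZMod m) :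
    dft (fun k => z (k + 1)) j = stdAddChar j * dft z j := by
  rw [dft_apply, dft_apply, mul_sum, ← Equiv.sum_comp (Equiv.addRight (1 : ZMod m))
    (fun k => stdAddChar j * (stdAddChar (-(k * j)) • z k))]
  refine sum_congr rfl fun k _ => ?_
  rw [Equiv.coe_addRight, smul_eq_mul, smul_eq_mul, ← mul_assoc, ← AddChar.map_add_eq_mul]
  congr 2
  ring

theorem mul_closedEnergy_eq_sum_dft (z : ZMod m → ℂ) :
    m * closedEnergy z = ∑ j, ‖dft z j‖ ^ 2 * ‖(stdAddChar j : ℂ) - 1‖ ^ 2 := by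
  have hdft (j) : dft (fun k => z (k + 1) - z k) j = (stdAddChar j - 1) * dft z j := by
    rw [sub_one_mul, ← dft_comp_add_one]
    exact congrFun (map_sub dft (fun k => z (k + 1)) z) j
  have parseval := sum_conj_dft_mul_dft (fun k => z (k + 1) - z k) (fun k => z (k + 1) - z k)
  simp only [hdft, Complex.conj_mul', norm_mul] at parseval
  have hdist (k) : dist (z k) (z (k + 1)) ^ 2 = ‖z (k + 1) - z k‖ ^ 2 := by
    rw [dist_comm, dist_eq_norm]
  simp only [closedEnergy, hdist, mul_comm (‖dft z _‖ ^ 2), ← mul_pow]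
  exact_mod_cast parseval.symm

theorem mul_signedArea_eq_sum_dft (z : ZMod m → ℂ) :
    m * (2 * signedArea z) = ∑ j, ‖dft z j‖ ^ 2 * (stdAddChar j : ℂ).im := by
  have parseval := congrArg Complex.im (sum_conj_dft_mul_dft z (fun k => z (k + 1)))
  simp only [dft_comp_add_one, mul_left_comm _ (stdAddChar _ : ℂ), Complex.conj_mul'] at parseval
  rw [← Complex.ofReal_natCast, Complex.im_ofReal_mul, Complex.im_sum, Complex.im_sum] at parseval
  simp only [← Complex.areaForm, ← Complex.ofReal_pow, Complex.im_mul_ofReal] at parseval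
  rw [signedArea, mul_div_cancel₀ _ two_ne_zero, ← parseval]
  exact sum_congr rfl fun j _ => mul_comm _ _

/-- The coefficient of `‖dft z j‖ ^ 2` in the Fourier expansion of the deficit
`m * (closedEnergy z - 4 * tan (π / m) * signedArea z)` of the Wirtinger inequality. -/
def wirtingerCoeff (j : ZMod m) : ℝ :=
  ‖(stdAddChar j : ℂ) - 1‖ ^ 2 - 2 * Real.tan (Real.pi / m) * (stdAddChar j : ℂ).im

theorem mul_closedEnergy_sub_signedArea_eq_sum (z : ZMod m → ℂ) :
    m * (closedEnergy z - 4 * Real.tan (Real.pi / m) * signedArea z) =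
      ∑ j, ‖dft z j‖ ^ 2 * wirtingerCoeff j := by
  have hsum : ∑ j, ‖dft z j‖ ^ 2 * wirtingerCoeff j = m * closedEnergy z -
      2 * Real.tan (Real.pi / m) * (m * (2 * signedArea z)) := by
    rw [mul_closedEnergy_eq_sum_dft, mul_signedArea_eq_sum_dft, mul_sum, ← sum_sub_distrib]
    exact sum_congr rfl fun j _ => by rw [wirtingerCoeff]; ring
  rw [hsum]
  ring

theorem wirtingerCoeff_eq (hm : 3 ≤ m) (j : ZMod m) :
    wirtingerCoeff j = 4 * Real.sin (Real.pi * j.val / m) *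
      Real.sin (Real.pi * j.val / m - Real.pi / m) / Real.cos (Real.pi / m) := by
  have hcos := (cos_pi_div_pos hm).ne'
  rw [wirtingerCoeff, norm_stdAddChar_sub_one, stdAddChar_im, Real.tan_eq_sin_div_cos,
    Real.sin_sub]
  field_simp
  ring

theorem wirtingerCoeff_pos (hm : 3 ≤ m) {j : ZMod m} (h0 : j ≠ 0) (h1 : j ≠ 1) :
    0 < wirtingerCoeff j := by
  have : Fact (1 < m) := ⟨by omega⟩
  have hval : (j - 1).val = j.val - 1 := by
    rw [ZMod.val_sub, ZMod.val_one]
    rw [ZMod.val_one]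
    exact Nat.one_le_iff_ne_zero.2 ((ZMod.val_ne_zero j).2 h0)
  have hshift : Real.pi * j.val / m - Real.pi / m = Real.pi * (j - 1).val / m := by
    rw [hval, Nat.cast_pred (Nat.pos_of_ne_zero ((ZMod.val_ne_zero j).2 h0))]
    ring
  rw [wirtingerCoeff_eq hm, hshift]
  have := sin_pi_mul_val_div_pos h0
  have := sin_pi_mul_val_div_pos (sub_ne_zero.2 h1)
  have := cos_pi_div_pos hm
  positivity

theorem wirtingerCoeff_nonneg (hm : 3 ≤ m) (j : ZMod m) : 0 ≤ wirtingerCoeff j := by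
  have : Fact (1 < m) := ⟨by omega⟩
  rcases eq_or_ne j 0 with rfl | h0
  · simp [wirtingerCoeff]
  rcases eq_or_ne j 1 with rfl | h1
  · simp [wirtingerCoeff_eq hm, ZMod.val_one]
  · exact (wirtingerCoeff_pos hm h0 h1).le

theorem four_mul_tan_mul_signedArea_le_closedEnergy (hm : 3 ≤ m) (z : ZMod m → ℂ) :
    4 * Real.tan (Real.pi / m) * signedArea z ≤ closedEnergy z := by
  have hdeficit : 0 ≤ m * (closedEnergy z - 4 * Real.tan (Real.pi / m) * signedArea z) := by
    rw [mul_closedEnergy_sub_signedArea_eq_sum]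
    exact sum_nonneg fun j _ => mul_nonneg (sq_nonneg _) (wirtingerCoeff_nonneg hm j)
  exact sub_nonneg.1 (nonneg_of_mul_nonneg_right hdeficit (by positivity))

/-- The vertices of a regular `m`-gon with centre `c` and a vertex at `c + b`, in counterclockwise
order. -/
def regularVertices (c b : ℂ) (k : ZMod m) : ℂ := c + b * stdAddChar k

theorem eq_regularVertices_of_signedArea_eq_closedEnergy (hm : 3 ≤ m) {z : ZMod m → ℂ}
    (h : 4 * Real.tan (Real.pi / m) * signedArea z = closedEnergy z) :
    ∃ c b, z = regularVertices c b := by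
  have : Fact (1 < m) := ⟨by omega⟩
  have hdft : ∀ j ∉ ({0, 1} : Finset (ZMod m)), dft z j = 0 := by
    intro j hj
    simp only [mem_insert, mem_singleton, not_or] at hj
    have hsum := mul_closedEnergy_sub_signedArea_eq_sum z
    rw [h, sub_self, mul_zero, eq_comm, sum_eq_zero_iff_of_nonneg fun j _ =>
      mul_nonneg (sq_nonneg _) (wirtingerCoeff_nonneg hm j)] at hsum
    simpa [(wirtingerCoeff_pos hm hj.1 hj.2).ne'] using hsum j (mem_univ _)
  refine ⟨(m : ℂ)⁻¹ * dft z 0, (m : ℂ)⁻¹ * dft z 1, funext fun k => ?_⟩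
  calc z k = (m : ℂ)⁻¹ • ∑ j ∈ {0, 1}, stdAddChar (j * k) • dft z j := by
        rw [sum_subset (subset_univ _) fun j _ hj => by rw [hdft j hj, smul_zero],
          ← invDFT_apply, LinearEquiv.symm_apply_apply]
    _ = regularVertices ((m : ℂ)⁻¹ * dft z 0) ((m : ℂ)⁻¹ * dft z 1) k := by
        rw [sum_pair zero_ne_one, zero_mul, one_mul, AddChar.map_zero_eq_one, one_smul,
          regularVertices, smul_eq_mul, smul_eq_mul]
        ring

end Wirtinger

/-! ### The isoperimetric inequality for the signed area of closed polygons -/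

section Isoperimetric

open scoped RealInnerProductSpace

variable {V : Type*} [NormedAddCommGroup V] [InnerProductSpace ℝ V]

theorem exists_dist_add_smul_eq
    (p q r : V) : ∃ t : ℝ, dist p (q + t • (r - p)) = dist (q + t • (r - p)) r := by
  rcases eq_or_ne r p with rfl | hne
  · exact ⟨0, dist_comm _ _⟩
  refine ⟨⟪midpoint ℝ p r - q, r - p⟫ / ‖r - p‖ ^ 2, ?_⟩
  have hnorm : ‖r - p‖ ^ 2 ≠ 0 := by simpa [sub_eq_zero] using hne
  rw [dist_comm p, ← AffineSubspace.mem_perpBisector_iff_dist_eq,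
    AffineSubspace.mem_perpBisector_iff_inner_eq_zero', vsub_eq_sub, vsub_eq_sub, real_inner_comm,
    add_sub_right_comm, inner_add_left, real_inner_smul_left, real_inner_self_eq_norm_sq,
    div_mul_cancel₀ _ hnorm, ← inner_add_left, sub_add_sub_cancel, sub_self, inner_zero_left]

theorem norm_sub_smul_add_eq_of_norm_eq {x y : V} (h : ‖x‖ = ‖y‖) (t : ℝ) :
    ‖x - t • (x + y)‖ = ‖y - t • (x + y)‖ := by
  rw [← sq_eq_sq₀ (norm_nonneg _) (norm_nonneg _), norm_sub_sq_real, norm_sub_sq_real, h,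
    real_inner_smul_right, real_inner_smul_right, inner_add_right, inner_add_right,
    real_inner_self_eq_norm_sq, real_inner_self_eq_norm_sq, h, real_inner_comm, add_comm (‖y‖ ^ 2)]

theorem norm_add_smul_add_eq_of_norm_eq {x y : V} (h : ‖x‖ = ‖y‖) (t : ℝ) :
    ‖y + t • (x + y)‖ = ‖x + t • (x + y)‖ := by
  simpa only [neg_smul, sub_neg_eq_add] using (norm_sub_smul_add_eq_of_norm_eq h (-t)).symm

theorem norm_sub_add_add (x z : V) : ‖x - z + (x + z)‖ = 2 * ‖x‖ := by
  rw [sub_add_add_cancel, ← two_smul ℝ, norm_smul, Real.norm_two]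

theorem norm_add_norm_le_of_norm_eq {x y : V} (h : ‖x‖ = ‖y‖) (t : ℝ) :
    ‖x‖ + ‖y‖ ≤ ‖x - t • (x + y)‖ + ‖y + t • (x + y)‖ := by
  rw [norm_add_smul_add_eq_of_norm_eq h, ← h, ← two_mul, ← norm_sub_add_add x]
  exact norm_add_le _ _

theorem norm_sq_add_norm_sq_lt_of_norm_eq {x y : V} (h : ‖x‖ = ‖y‖) (hxy : x + y ≠ 0) {t : ℝ}
    (ht : t ≠ 0) :
    ‖x‖ ^ 2 + ‖y‖ ^ 2 < ‖x - t • (x + y)‖ ^ 2 + ‖y + t • (x + y)‖ ^ 2 := by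
  have hpos : 0 < ‖t • (x + y)‖ := norm_pos_iff.2 (smul_ne_zero ht hxy)
  rw [norm_add_smul_add_eq_of_norm_eq h, ← h]
  nlinarith [parallelogram_law_with_norm ℝ x (t • (x + y))]

theorem norm_add_norm_lt_of_norm_eq {x y : ℂ} (h : ‖x‖ = ‖y‖) (hxy : ω x y ≠ 0) {t : ℝ}
    (ht : t ≠ 0) : ‖x‖ + ‖y‖ < ‖x - t • (x + y)‖ + ‖y + t • (x + y)‖ := by
  have harea : ω (x - t • (x + y)) (x + t • (x + y)) = 2 * t * ω x y := by
    simp only [areaForm_eq, Complex.add_re, Complex.add_im, Complex.sub_re, Complex.sub_im,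
      Complex.smul_re, Complex.smul_im, smul_eq_mul]
    ring
  have hray : ¬SameRay ℝ (x - t • (x + y)) (x + t • (x + y)) := fun hray =>
    mul_ne_zero (mul_ne_zero two_ne_zero ht) hxy
      (harea ▸ ((Orientation.nonneg_inner_and_areaForm_eq_zero_iff_sameRay _ _ _).2 hray).2)
  rw [norm_add_smul_add_eq_of_norm_eq h, ← h, ← two_mul, ← norm_sub_add_add x]
  exact norm_add_lt_of_not_sameRay hray

theorem exists_isosceles {p q r : ℂ} (h : dist p q ≠ dist q r) :
    ∃ q', ω (q' - q) (r - p) = 0 ∧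
      dist p q' + dist q' r ≤ dist p q + dist q r ∧
      dist p q' ^ 2 + dist q' r ^ 2 < dist p q ^ 2 + dist q r ^ 2 ∧
      (ω (q - p) (r - p) ≠ 0 → dist p q' + dist q' r < dist p q + dist q r) := by
  obtain ⟨t, hiso⟩ := exists_dist_add_smul_eq p q r
  have ht : t ≠ 0 := by
    rintro rfl
    exact h (by simpa using hiso)
  have hpr : r - p ≠ 0 := sub_ne_zero.2 fun hrp => h (by rw [hrp, dist_comm])
  refine ⟨q + t • (r - p), ?_⟩
  obtain ⟨x, hx⟩ : ∃ x, x = q + t • (r - p) - p := ⟨_, rfl⟩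
  obtain ⟨y, hy⟩ : ∃ y, y = r - (q + t • (r - p)) := ⟨_, rfl⟩
  have hxy : r - p = x + y := by rw [hx, hy]; abel
  have hpq : q - p = x - t • (x + y) := by rw [← hxy, hx]; abel
  have hqr : r - q = y + t • (x + y) := by rw [← hxy, hy]; abel
  have harea : ω (q - p) (r - p) = ω x y := by
    rw [hpq, hxy, map_sub, map_smul, LinearMap.sub_apply, LinearMap.smul_apply,
      Orientation.areaForm_apply_self, smul_zero, sub_zero, map_add,
      Orientation.areaForm_apply_self, zero_add]
  simp only [dist_comm p, dist_comm _ r, dist_eq_norm, ← hx, ← hy] at hiso ⊢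
  rw [harea, hpq, hqr, add_sub_cancel_left, map_smul, LinearMap.smul_apply,
    Orientation.areaForm_apply_self, smul_zero]
  rw [hxy] at hpr
  exact ⟨rfl, norm_add_norm_le_of_norm_eq hiso t, norm_sq_add_norm_sq_lt_of_norm_eq hiso hpr ht,
    fun hne => norm_add_norm_lt_of_norm_eq hiso hne ht⟩

variable {m : ℕ}

theorem rho_pos (hm : 3 ≤ m) : 0 < rho m :=
  mul_pos (by positivity) (tan_pi_div_pos hm)

variable [NeZero m]

theorem sum_update {α M : Type*} [AddCommGroup M] [Fact (1 < m)] (f : α → α → M) (w : ZMod m → α)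
    (k : ZMod m) (q : α) :
    ∑ j, f (Function.update w (k + 1) q j) (Function.update w (k + 1) q (j + 1)) =
      ∑ j, f (w j) (w (j + 1)) +
        (f (w k) q + f q (w (k + 2)) - (f (w k) (w (k + 1)) + f (w (k + 1)) (w (k + 2)))) := by
  have hk : k ≠ k + 1 := by simp
  have hk2 : k + 2 ≠ k + 1 := by simp [← one_add_one_eq_two, ← add_assoc]
  rw [← sub_eq_iff_eq_add', ← sum_sub_distrib, ← sum_subset (subset_univ {k, k + 1}), sum_pair hk,
    Function.update_self, Function.update_of_ne hk, add_assoc k 1 1, one_add_one_eq_two,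
    Function.update_of_ne hk2]
  · abel
  · intro j _ hj
    simp only [mem_insert, mem_singleton, not_or] at hj
    rw [Function.update_of_ne hj.2, Function.update_of_ne (by simpa using hj.1), sub_self]

theorem signedArea_update [Fact (1 < m)] (w : ZMod m → ℂ) (k : ZMod m) (q : ℂ) :
    signedArea (Function.update w (k + 1) q) =
      signedArea w + ω (q - w (k + 1)) (w (k + 2) - w k) / 2 := by
  rw [signedArea, sum_update (fun a b => ω a b), signedArea, ← add_div]
  simp only [areaForm_eq, Complex.sub_re, Complex.sub_im]
  ring

theorem closedLength_update {X : Type*} [PseudoMetricSpace X] [Fact (1 < m)] (w : ZMod m → X)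
    (k : ZMod m) (q : X) :
    closedLength (Function.update w (k + 1) q) = closedLength w +
      (dist (w k) q + dist q (w (k + 2)) -
        (dist (w k) (w (k + 1)) + dist (w (k + 1)) (w (k + 2)))) :=
  sum_update dist w k q

theorem closedEnergy_update {X : Type*} [PseudoMetricSpace X] [Fact (1 < m)] (w : ZMod m → X)
    (k : ZMod m) (q : X) :
    closedEnergy (Function.update w (k + 1) q) = closedEnergy w +
      (dist (w k) q ^ 2 + dist q (w (k + 2)) ^ 2 -
        (dist (w k) (w (k + 1)) ^ 2 + dist (w (k + 1)) (w (k + 2)) ^ 2)) :=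
  sum_update (dist · · ^ 2) w k q

theorem signedArea_sub_const (w : ZMod m → ℂ) (c : ℂ) :
    signedArea (fun k => w k - c) = signedArea w := by
  have hshift : ∑ k, ω (w (k + 1)) c = ∑ k, ω (w k) c :=
    Equiv.sum_comp (Equiv.addRight (1 : ZMod m)) fun k => ω (w k) c
  have hcross (a b : ℂ) : ω (a - c) (b - c) = ω a b + (ω b c - ω a c) := by
    simp only [areaForm_eq, Complex.sub_re, Complex.sub_im]
    ring
  simp only [signedArea, hcross, sum_add_distrib, sum_sub_distrib, hshift, sub_self, add_zero]

theorem continuous_signedArea : Continuous (signedArea : (ZMod m → ℂ) → ℝ) := by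
  unfold signedArea
  simp only [areaForm_eq]
  fun_prop

theorem continuous_closedLength {X : Type*} [PseudoMetricSpace X] :
    Continuous (closedLength : (ZMod m → X) → ℝ) := by
  unfold closedLength
  fun_prop

theorem continuous_closedEnergy {X : Type*} [PseudoMetricSpace X] :
    Continuous (closedEnergy : (ZMod m → X) → ℝ) := by
  unfold closedEnergy
  fun_prop

theorem closedLength_nonneg {X : Type*} [PseudoMetricSpace X] (w : ZMod m → X) :
    0 ≤ closedLength w :=
  sum_nonneg fun _ _ => dist_nonneg

theorem dist_le_mul_closedLength {X : Type*} [PseudoMetricSpace X] (w : ZMod m → X) (n : ℕ) :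
    dist (w 0) (w n) ≤ n * closedLength w :=
  calc dist (w 0) (w n) ≤ ∑ i ∈ range n, dist (w i) (w (i + 1)) := by
        simpa using dist_le_range_sum_dist (fun i : ℕ => w i) n
    _ ≤ n * closedLength w := by
        simpa [closedLength] using sum_le_card_nsmul (range n) _ _ fun i _ =>
          single_le_sum (f := fun k => dist (w k) (w (k + 1))) (fun _ _ => dist_nonneg)
            (mem_univ (i : ZMod m))

theorem dist_le_card_mul_closedLength {X : Type*} [PseudoMetricSpace X] (w : ZMod m → X)
    (k : ZMod m) : dist (w 0) (w k) ≤ m * closedLength w := by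
  have hval : (k.val : ℝ) ≤ m := by exact_mod_cast (ZMod.val_lt k).le
  have hdist := dist_le_mul_closedLength w k.val
  rw [ZMod.natCast_zmod_val] at hdist
  exact hdist.trans (mul_le_mul_of_nonneg_right hval (closedLength_nonneg w))

theorem exists_forall_closedEnergy_le (v : ZMod m → ℂ) :
    ∃ w : ZMod m → ℂ, closedLength w ≤ closedLength v ∧ signedArea v ≤ signedArea w ∧
      ∀ u : ZMod m → ℂ, closedLength u ≤ closedLength v → signedArea v ≤ signedArea u →
        closedEnergy w ≤ closedEnergy u := by
  let K : Set (ZMod m → ℂ) :=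
    {w | w 0 = 0 ∧ closedLength w ≤ closedLength v ∧ signedArea v ≤ signedArea w}
  have hcentre (u : ZMod m → ℂ) (hL : closedLength u ≤ closedLength v)
      (hS : signedArea v ≤ signedArea u) : (fun k => u k - u 0) ∈ K :=
    ⟨sub_self _, by simpa [closedLength] using hL, by rwa [signedArea_sub_const]⟩
  have hclosed : IsClosed K :=
    (isClosed_eq (continuous_apply 0) continuous_const).inter
      ((isClosed_le continuous_closedLength continuous_const).inter
        (isClosed_le continuous_const continuous_signedArea))
  have hbounded : K ⊆ Metric.closedBall 0 (m * closedLength v) := by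
    rintro w ⟨h0, hL, -⟩
    rw [mem_closedBall_zero_iff, pi_norm_le_iff_of_nonneg (by
      have := closedLength_nonneg v; positivity)]
    intro k
    calc ‖w k‖ = dist (w 0) (w k) := by rw [h0, dist_zero_left]
      _ ≤ m * closedLength w := dist_le_card_mul_closedLength w k
      _ ≤ m * closedLength v := by gcongr
  obtain ⟨w, hw, hmin⟩ := ((isCompact_closedBall _ _).of_isClosed_subset hclosed hbounded)
    |>.exists_isMinOn ⟨_, hcentre v le_rfl le_rfl⟩ continuous_closedEnergy.continuousOn
  refine ⟨w, hw.2.1, hw.2.2, fun u hL hS => ?_⟩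
  simpa [closedEnergy] using hmin (hcentre u hL hS)

theorem dist_eq_dist_of_forall_closedEnergy_le [Fact (1 < m)] {w : ZMod m → ℂ}
    (hmin : ∀ u : ZMod m → ℂ, closedLength u ≤ closedLength w → signedArea w ≤ signedArea u →
      closedEnergy w ≤ closedEnergy u) (k : ZMod m) :
    dist (w k) (w (k + 1)) = dist (w (k + 1)) (w (k + 2)) := by
  by_contra hne
  obtain ⟨q, harea, hlength, henergy, -⟩ := exists_isosceles hne
  have hle := hmin (Function.update w (k + 1) q) (by rw [closedLength_update]; linarith)
    (by rw [signedArea_update, harea, zero_div, add_zero])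
  rw [closedEnergy_update] at hle
  linarith

theorem mul_closedEnergy_eq_closedLength_sq {X : Type*} [PseudoMetricSpace X] {w : ZMod m → X}
    (h : ∀ k, dist (w k) (w (k + 1)) = dist (w (k + 1)) (w (k + 2))) :
    m * closedEnergy w = closedLength w ^ 2 := by
  have hconst (k : ZMod m) : dist (w k) (w (k + 1)) = dist (w 0) (w 1) := by
    obtain ⟨n, rfl⟩ := ZMod.natCast_zmod_surjective k
    induction n with
    | zero => simp
    | succ n ih => rw [← ih, h n, Nat.cast_succ, add_assoc, one_add_one_eq_two]
  simp only [closedEnergy, closedLength, hconst, sum_const, card_univ, ZMod.card, nsmul_eq_mul]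
  ring

theorem four_mul_rho_mul_signedArea_le_mul_closedEnergy (hm : 3 ≤ m) (w : ZMod m → ℂ) :
    4 * rho m * signedArea w ≤ m * closedEnergy w := by
  rw [rho]
  linarith [mul_le_mul_of_nonneg_left (four_mul_tan_mul_signedArea_le_closedEnergy hm w)
    (Nat.cast_nonneg m)]

theorem four_mul_rho_mul_signedArea_le (hm : 3 ≤ m) (v : ZMod m → ℂ) :
    4 * rho m * signedArea v ≤ closedLength v ^ 2 := by
  have : Fact (1 < m) := ⟨by omega⟩
  have hρ := rho_pos hm
  obtain ⟨w, hlength, harea, hmin⟩ := exists_forall_closedEnergy_le v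
  have hsides := dist_eq_dist_of_forall_closedEnergy_le fun u hL hS =>
    hmin u (hL.trans hlength) (harea.trans hS)
  calc 4 * rho m * signedArea v ≤ 4 * rho m * signedArea w := by gcongr
    _ ≤ m * closedEnergy w := four_mul_rho_mul_signedArea_le_mul_closedEnergy hm w
    _ = closedLength w ^ 2 := mul_closedEnergy_eq_closedLength_sq hsides
    _ ≤ closedLength v ^ 2 := pow_le_pow_left₀ (closedLength_nonneg w) hlength 2

-- A middle point on the line through its neighbours: moving it off the line changes the area to
-- first order in `s`, but the length only to second order.
theorem exists_bump_of_collinear {p q r : ℂ} (h : ω (q - p) (r - p) = 0) (s : ℝ) :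
    ∃ q', ω (q' - q) (r - p) = s * ‖r - p‖ ^ 2 ∧
      dist p q' + dist q' r ≤ dist p q + dist q r + 2 * ‖r - p‖ * s ^ 2 := by
  set D := r - p with hD
  refine ⟨p + (1 / 2 + (-s : ℝ) * Complex.I) * D, ?_, ?_⟩
  · have hmid : p + (1 / 2 + (-s : ℝ) * Complex.I) * D - q =
        (1 / 2 + (-s : ℝ) * Complex.I) * D - (q - p) := by ring
    rw [hmid, LinearMap.map_sub₂, h, sub_zero, ← Complex.normSq_eq_norm_sq, areaForm_eq,
      Complex.normSq_apply]
    simp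
    ring
  · have hnorm (a : ℝ) : ‖(1 / 2 + a * Complex.I) * D‖ ≤ (1 / 2 + a ^ 2) * ‖D‖ := by
      rw [norm_mul]
      gcongr
      rw [← Complex.ofReal_one, ← Complex.ofReal_ofNat, ← Complex.ofReal_div,
        Complex.norm_add_mul_I]
      exact Real.sqrt_le_iff.2 ⟨by positivity, by nlinarith [sq_nonneg (a ^ 2)]⟩
    have hleft : dist p (p + (1 / 2 + (-s : ℝ) * Complex.I) * D) ≤ (1 / 2 + s ^ 2) * ‖D‖ := by
      simpa using hnorm (-s)
    have hright : dist (p + (1 / 2 + (-s : ℝ) * Complex.I) * D) r ≤ (1 / 2 + s ^ 2) * ‖D‖ := by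
      have hr : r - (p + (1 / 2 + (-s : ℝ) * Complex.I) * D) = (1 / 2 + s * Complex.I) * D := by
        rw [hD]
        push_cast
        ring
      rw [dist_comm, dist_eq_norm, hr]
      exact hnorm s
    have htriangle : ‖D‖ ≤ dist p q + dist q r := by
      rw [hD, ← dist_eq_norm, dist_comm]
      exact dist_triangle p q r
    linarith

theorem areaForm_ne_zero_of_signedArea_eq (hm : 3 ≤ m) {w : ZMod m → ℂ}
    (hw : 4 * rho m * signedArea w = closedLength w ^ 2) {k : ZMod m} (hk : w k ≠ w (k + 2)) :
    ω (w (k + 1) - w k) (w (k + 2) - w k) ≠ 0 := by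
  intro hcol
  have : Fact (1 < m) := ⟨by omega⟩
  have hD : 0 < ‖w (k + 2) - w k‖ := norm_sub_pos_iff.2 hk.symm
  set D := w (k + 2) - w k
  let defect (s : ℝ) : ℝ := (closedLength w + 2 * ‖D‖ * s ^ 2) ^ 2 -
    4 * rho m * (signedArea w + s * ‖D‖ ^ 2 / 2)
  have hnonneg (s : ℝ) : 0 ≤ defect s := by
    obtain ⟨q, harea, hlength⟩ := exists_bump_of_collinear hcol s
    have hiso := four_mul_rho_mul_signedArea_le hm (Function.update w (k + 1) q)
    rw [signedArea_update, harea] at hiso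
    exact sub_nonneg.2 (hiso.trans (pow_le_pow_left₀ (closedLength_nonneg _)
      (by rw [closedLength_update]; linarith) 2))
  have hmin : IsLocalMin defect 0 := Filter.Eventually.of_forall fun s => by
    simpa [defect, hw] using hnonneg s
  have hderiv : HasDerivAt defect (-(4 * rho m * (‖D‖ ^ 2 / 2))) 0 := by
    have hlength := ((((hasDerivAt_id (0 : ℝ)).fun_pow 2).const_mul (2 * ‖D‖)).const_add
      (closedLength w)).fun_pow 2
    have harea := ((((hasDerivAt_id (0 : ℝ)).mul_const (‖D‖ ^ 2)).div_const 2).const_add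
      (signedArea w)).const_mul (4 * rho m)
    simpa [defect] using hlength.fun_sub harea
  have hpos : 0 < 4 * rho m * (‖D‖ ^ 2 / 2) := by
    have := rho_pos hm
    positivity
  exact hpos.ne' (neg_eq_zero.1 (hmin.hasDerivAt_eq_zero hderiv))

theorem eq_regularVertices_of_signedArea_eq (hm : 3 ≤ m) {w : ZMod m → ℂ}
    (hw : 4 * rho m * signedArea w = closedLength w ^ 2) : ∃ c b, w = regularVertices c b := by
  have : Fact (1 < m) := ⟨by omega⟩
  have hsides (k : ZMod m) : dist (w k) (w (k + 1)) = dist (w (k + 1)) (w (k + 2)) := by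
    by_contra hne
    obtain ⟨q, harea, -, -, hlt⟩ := exists_isosceles hne
    have hends : w k ≠ w (k + 2) := fun h => hne (by rw [← h, dist_comm])
    have hiso := four_mul_rho_mul_signedArea_le hm (Function.update w (k + 1) q)
    rw [signedArea_update, harea, zero_div, add_zero, hw] at hiso
    refine hiso.not_gt (pow_lt_pow_left₀ ?_ (closedLength_nonneg _) two_ne_zero)
    rw [closedLength_update]
    linarith [hlt (areaForm_ne_zero_of_signedArea_eq hm hw hends)]
  refine eq_regularVertices_of_signedArea_eq_closedEnergy hm ?_
  have hm0 : (m : ℝ) ≠ 0 := NeZero.ne _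
  rw [← mul_closedEnergy_eq_closedLength_sq hsides, rho] at hw
  exact mul_left_cancel₀ hm0 (by linarith)

end Isoperimetric

/-! ### Closed tours through a list of points -/

section Tours

variable {α M : Type*} [AddCommMonoid M]

/-- The pairs of consecutive points on the path that starts at `a`, runs through `l` and ends
at `x`. -/
def pathEdges (a : α) (l : List α) (x : α) : List (α × α) := (a :: l).zip (l ++ [x])

/-- The pairs of cyclically consecutive entries of a list, which we regard as a closed tour. -/
def tourEdges (l : List α) : List (α × α) := l.zip (l.rotate 1)

/-- The sum of `f` over the edges of the path from `a` through `l` to `x`. -/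
def pathSum (f : α → α → M) (a : α) (l : List α) (x : α) : M :=
  ((pathEdges a l x).map fun e => f e.1 e.2).sum

/-- The sum of `f` over the edges of the closed tour `l`; for `f = dist` the length of the tour, for
the area form twice its signed area. -/
def tourSum (f : α → α → M) (l : List α) : M := ((tourEdges l).map fun e => f e.1 e.2).sum

theorem pathSum_nil (f : α → α → M) (a x : α) : pathSum f a [] x = f a x := by
  simp [pathSum, pathEdges]

theorem pathSum_cons (f : α → α → M) (a b : α) (l : List α) (x : α) :
    pathSum f a (b :: l) x = f a b + pathSum f b l x := by
  simp [pathSum, pathEdges]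

theorem tourSum_nil (f : α → α → M) : tourSum f [] = 0 := rfl

theorem tourSum_cons (f : α → α → M) (a : α) (l : List α) :
    tourSum f (a :: l) = pathSum f a l a := by
  simp [tourSum, tourEdges, pathSum, pathEdges]

theorem pathSum_append_cons (f : α → α → M) (a b x : α) (l l' : List α) :
    pathSum f a (l ++ b :: l') x = pathSum f a l b + pathSum f b l' x := by
  induction l generalizing a with
  | nil => rw [List.nil_append, pathSum_cons, pathSum_nil]
  | cons c l ih => rw [List.cons_append, pathSum_cons, pathSum_cons, ih, add_assoc]

theorem pathSum_reverse {f : α → α → M} (hf : ∀ a b, f a b = f b a) (a x : α) (l : List α) :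
    pathSum f x l.reverse a = pathSum f a l x := by
  induction l generalizing a with
  | nil => simp only [List.reverse_nil, pathSum_nil, hf]
  | cons b l ih =>
    rw [List.reverse_cons, pathSum_append_cons, pathSum_nil, ih, pathSum_cons, hf b a, add_comm]

theorem tourSum_append_singleton (f : α → α → M) (a : α) (l : List α) :
    tourSum f (l ++ [a]) = tourSum f (a :: l) := by
  cases l with
  | nil => rfl
  | cons b l =>
    rw [List.cons_append, tourSum_cons, tourSum_cons, pathSum_append_cons, pathSum_nil,
      pathSum_cons, add_comm]

theorem tourSum_rotate (f : α → α → M) (l : List α) (n : ℕ) :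
    tourSum f (l.rotate n) = tourSum f l := by
  induction n generalizing l with
  | zero => rw [List.rotate_zero]
  | succ n ih =>
    cases l with
    | nil => rfl
    | cons a l => rw [List.rotate_cons_succ, ih, tourSum_append_singleton]

theorem tourSum_reverse {f : α → α → M} (hf : ∀ a b, f a b = f b a) (l : List α) :
    tourSum f l.reverse = tourSum f l := by
  cases l with
  | nil => rfl
  | cons a l =>
    rw [List.reverse_cons, tourSum_append_singleton, tourSum_cons, tourSum_cons,
      pathSum_reverse hf]

theorem tourSum_replicate_append {f : α → α → M} (hf : ∀ a, f a a = 0) (a : α) (l : List α)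
    (n : ℕ) : tourSum f (List.replicate n a ++ a :: l) = tourSum f (a :: l) := by
  induction n with
  | zero => rfl
  | succ n ih =>
    have hcons (s : List α) : tourSum f (a :: a :: s) = tourSum f (a :: s) := by
      rw [tourSum_cons, pathSum_cons, hf, zero_add, tourSum_cons]
    rw [← ih]
    cases n with
    | zero => exact hcons l
    | succ n => exact hcons _

theorem tourSum_eq_sum {m : ℕ} [NeZero m] (f : α → α → M) (l : List α) (hl : l.length = m)
    {w : ZMod m → α} (hw : ∀ k : ZMod m, w k = l[k.val]'(hl ▸ ZMod.val_lt k)) :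
    tourSum f l = ∑ k, f (w k) (w (k + 1)) := by
  have hofFn : (tourEdges l).map (fun e => f e.1 e.2) =
      List.ofFn fun i : Fin m => f (w (ZMod.finEquiv m i)) (w (ZMod.finEquiv m i + 1)) := by
    refine List.ext_getElem (by simp [tourEdges, hl]) fun i hi hi' => ?_
    have hilt : i < m := by simpa using hi'
    have hval : (ZMod.finEquiv m ⟨i, hilt⟩).val = i := by
      cases m with
      | zero => exact absurd rfl (NeZero.ne 0)
      | succ n => rfl
    simp only [tourEdges, List.getElem_map, List.getElem_zip, List.getElem_rotate,
      List.getElem_ofFn, hw, hl, hval, ZMod.val_add, ZMod.val_one_eq_one_mod, Nat.add_mod_mod]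
  rw [tourSum, hofFn, List.sum_ofFn]
  exact (ZMod.finEquiv m).toEquiv.sum_comp fun k => f (w k) (w (k + 1))

end Tours

section TourLength

variable {X : Type*} [PseudoMetricSpace X]

theorem pathSum_dist_le_of_sublist {l l' : List X} (h : l.Sublist l') (a x : X) :
    pathSum dist a l x ≤ pathSum dist a l' x := by
  induction h generalizing a with
  | slnil => exact le_rfl
  | @cons l l' b _ ih =>
    have hdetour : pathSum dist a l x ≤ dist a b + pathSum dist b l x := by
      cases l with
      | nil => simpa only [pathSum_nil] using dist_triangle a b x
      | cons c l => simpa only [pathSum_cons, add_assoc] using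
          add_le_add_left (dist_triangle a b c) (pathSum dist c l x)
    rw [pathSum_cons]
    exact hdetour.trans (add_le_add_right (ih b) _)
  | cons_cons b _ ih => simpa only [pathSum_cons] using add_le_add_right (ih b) (dist a b)

theorem tourSum_dist_le_of_sublist {l l' : List X} (h : l.Sublist l') :
    tourSum dist l ≤ tourSum dist l' := by
  induction h with
  | slnil => exact le_rfl
  | @cons l l' a _ ih =>
    refine ih.trans ?_
    cases l' with
    | nil => rw [tourSum_nil, tourSum_cons, pathSum_nil, dist_self]
    | cons b l' =>
      rw [← tourSum_append_singleton dist a, List.cons_append, tourSum_cons, tourSum_cons]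
      exact pathSum_dist_le_of_sublist (List.sublist_append_left _ _) b b
  | cons_cons a h _ =>
    rw [tourSum_cons, tourSum_cons]
    exact pathSum_dist_le_of_sublist h a a

-- The two-opt move: reversing the stretch `b :: l ++ [c]` of a tour exchanges two of its edges.
theorem tourSum_dist_two_opt (a b c d : X) (l l' : List X) :
    tourSum dist (a :: c :: l.reverse ++ b :: d :: l') + (dist a b + dist c d) =
      tourSum dist (a :: b :: l ++ c :: d :: l') + (dist a c + dist b d) := by
  simp only [List.cons_append, tourSum_cons, pathSum_cons, pathSum_append_cons,
    pathSum_reverse dist_comm b c l]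
  ring

end TourLength

/-! ### Shortest tours through points in convex position -/

section ConvexPosition

variable {E : Type*}

theorem exists_convexIndependent_sublist [NormedAddCommGroup E] [NormedSpace ℝ E] (l : List E) :
    ∃ l' : List E, l'.Sublist l ∧ l'.Nodup ∧
      ConvexIndependent ℝ ((↑) : {x | x ∈ l'} → E) ∧ ∀ x ∈ l, x ∈ convexHull ℝ {y | y ∈ l'} := by
  classical
  set K := convexHull ℝ {x | x ∈ l}
  have hK : Convex ℝ K := convex_convexHull ℝ _
  have hmem : {x | x ∈ (l.filter (· ∈ K.extremePoints ℝ)).dedup} = K.extremePoints ℝ := by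
    ext x
    have hsub : x ∈ K.extremePoints ℝ → x ∈ {y | y ∈ l} :=
      fun hx => extremePoints_convexHull_subset hx
    simpa using hsub
  refine ⟨(l.filter (· ∈ K.extremePoints ℝ)).dedup,
    (List.dedup_sublist _).trans List.filter_sublist, List.nodup_dedup _, ?_, fun x hx => ?_⟩
  · rw [hmem]
    exact hK.convexIndependent_extremePoints
  · have hfin : (K.extremePoints ℝ).Finite :=
      (List.finite_toSet l).subset extremePoints_convexHull_subset
    have hKm := closure_convexHull_extremePoints ((List.finite_toSet l).isCompact_convexHull ℝ) hK
    rw [(hfin.isClosed_convexHull ℝ).closure_eq] at hKm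
    rw [hmem, hKm]
    exact subset_convexHull ℝ _ hx

theorem notMem_convexHull_of_convexIndependent [AddCommGroup E] [Module ℝ E] {s t : Set E}
    (hs : ConvexIndependent ℝ ((↑) : s → E)) {x : E} (hx : x ∈ s) (ht : t ⊆ s \ {x}) :
    x ∉ convexHull ℝ t :=
  fun h => convexIndependent_set_iff_notMem_convexHull_sdiff.1 hs x hx (convexHull_mono ht h)

theorem collinear_of_areaForm_eq_zero {a b c : ℂ} (h : ω (b - a) (c - a) = 0) :
    Collinear ℝ {a, b, c} := by
  rcases eq_or_ne b a with rfl | hba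
  · simpa using collinear_pair ℝ b c
  have hreal : (((c - a) / (b - a)).re : ℂ) = (c - a) / (b - a) := by
    refine Complex.ext (Complex.ofReal_re _) ?_
    rw [areaForm_eq] at h
    rw [Complex.ofReal_im, Complex.div_im, ← sub_div, eq_comm, div_eq_zero_iff]
    left
    linarith
  refine (collinear_iff_of_mem (Set.mem_insert a _)).2 ⟨b - a, ?_⟩
  rintro x (rfl | rfl | rfl)
  · exact ⟨0, by simp⟩
  · exact ⟨1, by simp⟩
  · refine ⟨((x - a) / (b - a)).re, ?_⟩
    rw [Complex.real_smul, hreal, div_mul_cancel₀ _ (sub_ne_zero.2 hba), vadd_eq_add,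
      sub_add_cancel]

theorem areaForm_ne_zero_of_convexIndependent {s : Set ℂ}
    (hs : ConvexIndependent ℝ ((↑) : s → ℂ)) {a b c : ℂ} (ha : a ∈ s) (hb : b ∈ s) (hc : c ∈ s)
    (hab : a ≠ b) (hac : a ≠ c) (hbc : b ≠ c) : ω (b - a) (c - a) ≠ 0 := by
  have hwbtw {x y z : ℂ} (hx : x ∈ s) (hy : y ∈ s) (hz : z ∈ s) (hxy : x ≠ y) (hyz : y ≠ z) :
      ¬ Wbtw ℝ x y z := fun h =>
    notMem_convexHull_of_convexIndependent hs hy (t := {x, z})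
      (by rintro w (rfl | rfl); exacts [⟨hx, hxy⟩, ⟨hz, hyz.symm⟩])
      (by rw [convexHull_pair]; exact mem_segment_iff_wbtw.2 h)
  intro h
  rcases (collinear_of_areaForm_eq_zero h).wbtw_or_wbtw_or_wbtw with h | h | h
  exacts [hwbtw ha hb hc hab hbc h, hwbtw hb hc ha hbc hac.symm h, hwbtw hc ha hb hac.symm hab h]

theorem exists_mem_segment_eq_zero {c d : ℂ} {f : ℂ → ℝ} (hf : Continuous f) (h : f c * f d < 0) :
    ∃ q ∈ segment ℝ c d, f q = 0 := by
  have himage : Set.uIcc (f c) (f d) ⊆ f '' segment ℝ c d :=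
    ((convex_segment c d).isPreconnected.image f hf.continuousOn).ordConnected.uIcc_subset
      (Set.mem_image_of_mem f (left_mem_segment ℝ c d))
      (Set.mem_image_of_mem f (right_mem_segment ℝ c d))
  refine himage (Set.mem_uIcc.2 ?_)
  rcases mul_neg_iff.1 h with ⟨hc, hd⟩ | ⟨hc, hd⟩
  exacts [Or.inr ⟨hd.le, hc.le⟩, Or.inl ⟨hc.le, hd.le⟩]

-- `ab` and `cd` are the diagonals of a convex quadrilateral; at the point `q` where they cross, the
-- triangle inequality compares them with the sides `ac` and `bd`.
theorem dist_add_dist_lt_of_areaForm_mul_neg {a b c d : ℂ} (ha : a ∉ convexHull ℝ {b, c, d})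
    (hb : b ∉ convexHull ℝ {a, c, d}) (h : ω (b - a) (c - a) * ω (b - a) (d - a) < 0) :
    dist a c + dist b d < dist a b + dist c d := by
  obtain ⟨q, hq, hqab⟩ := exists_mem_segment_eq_zero (f := fun z => ω (b - a) (z - a))
    (by fun_prop) h
  have hcd (x : ℂ) : q ∈ convexHull ℝ {x, c, d} :=
    segment_subset_convexHull (by simp) (by simp) hq
  have haq : a ≠ q := fun h => ha (h ▸ hcd b)
  have hqab' : Wbtw ℝ b q a := by
    rcases (collinear_of_areaForm_eq_zero hqab).wbtw_or_wbtw_or_wbtw with h | h | h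
    · exact absurd ((convex_convexHull ℝ _).segment_subset (subset_convexHull ℝ _ (by simp))
        (hcd a) (mem_segment_iff_wbtw.2 h)) hb
    · exact h
    · exact absurd ((convex_convexHull ℝ _).segment_subset (hcd b)
        (subset_convexHull ℝ _ (by simp)) (mem_segment_iff_wbtw.2 h)) ha
  have haqc : ¬ Wbtw ℝ a q c := by
    rintro ⟨r, -, hr⟩
    have hqr : q - a = r • (c - a) := by rw [← hr, AffineMap.lineMap_apply]; simp
    have hr0 : r ≠ 0 := fun h0 => haq (sub_eq_zero.1 (by rw [hqr, h0, zero_smul])).symm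
    simp only [hqr, map_smul, smul_eq_mul, mul_eq_zero, hr0, false_or] at hqab
    rw [hqab, zero_mul] at h
    exact lt_irrefl 0 h
  have hstrict := dist_lt_dist_add_dist_iff.2 haqc
  have hab := hqab'.dist_add_dist
  have hcqd := (mem_segment_iff_wbtw.1 hq).dist_add_dist
  have htri := dist_triangle b q d
  rw [dist_comm q a, dist_comm b a] at hab
  rw [dist_comm q c] at hstrict
  linarith

end ConvexPosition

section ShortestTour

theorem mul_pos_of_forall_mul_pos {α : Type*} {s : α → ℝ} {l : List α} (hs : ∀ p ∈ l, s p ≠ 0)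
    (hadj : ∀ X c d Y, l = X ++ c :: d :: Y → 0 < s c * s d) :
    ∀ p ∈ l, ∀ q ∈ l, 0 < s p * s q := by
  have htrans : IsTrans α fun p q => 0 < s p * s q := ⟨fun p q r hpq hqr => by
    have := mul_pos hpq hqr
    nlinarith [sq_nonneg (s q)]⟩
  have hchain : l.IsChain fun p q => 0 < s p * s q :=
    List.isChain_iff_forall_rel_of_append_cons_cons.2 fun _ _ _ _ => hadj _ _ _ _
  have hsymm : Std.Symm fun p q => 0 < s p * s q := ⟨fun p q h => by rwa [mul_comm]⟩
  exact fun p hp q hq => (List.isChain_iff_pairwise.1 hchain).forall_of_forall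
    (fun p hp => mul_self_pos.2 (hs p hp)) hp hq

/-- A tour through points in convex position that is shortest among all its reorderings. -/
structure IsShortestTour (l : List ℂ) : Prop where
  nodup : l.Nodup
  convexIndependent : ConvexIndependent ℝ ((↑) : {x | x ∈ l} → ℂ)
  le_of_perm : ∀ l' : List ℂ, l'.Perm l → tourSum dist l ≤ tourSum dist l'

theorem exists_isShortestTour (l : List ℂ) (hl : l.Nodup)
    (hl' : ConvexIndependent ℝ ((↑) : {x | x ∈ l} → ℂ)) :
    ∃ l' : List ℂ, l'.Perm l ∧ IsShortestTour l' := by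
  classical
  obtain ⟨l', hperm, hmin⟩ := l.permutations.toFinset.exists_min_image (tourSum dist) ⟨l, by simp⟩
  simp only [List.mem_toFinset, List.mem_permutations] at hperm hmin
  have hset : {x | x ∈ l'} = {x | x ∈ l} := Set.ext fun _ => hperm.mem_iff
  exact ⟨l', hperm, hperm.nodup_iff.2 hl, hset ▸ hl', fun l'' h => hmin l'' (h.trans hperm)⟩

theorem IsShortestTour.of_perm {l l' : List ℂ} (h : IsShortestTour l) (hperm : l'.Perm l)
    (hsum : tourSum dist l' = tourSum dist l) : IsShortestTour l' where
  nodup := hperm.nodup_iff.2 h.nodup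
  convexIndependent := by
    have hset : {x | x ∈ l'} = {x | x ∈ l} := Set.ext fun _ => hperm.mem_iff
    exact hset ▸ h.convexIndependent
  le_of_perm l'' h'' := hsum.trans_le (h.le_of_perm l'' (h''.trans hperm))

theorem IsShortestTour.rotate {l : List ℂ} (h : IsShortestTour l) (n : ℕ) :
    IsShortestTour (l.rotate n) :=
  h.of_perm (List.rotate_perm l n) (tourSum_rotate dist l n)

theorem IsShortestTour.reverse {l : List ℂ} (h : IsShortestTour l) : IsShortestTour l.reverse :=
  h.of_perm l.reverse_perm (tourSum_reverse dist_comm l)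

-- Otherwise two consecutive points lie on different sides of the edge `ab`, and a two-opt move
-- shortens the tour.
theorem IsShortestTour.areaForm_mul_pos {a b : ℂ} {l : List ℂ} (h : IsShortestTour (a :: b :: l)) :
    ∀ p ∈ l, ∀ q ∈ l, 0 < ω (b - a) (p - a) * ω (b - a) (q - a) := by
  obtain ⟨⟨hab, hal⟩, hbl⟩ : (a ≠ b ∧ a ∉ l) ∧ b ∉ l := by
    have := h.nodup
    grind
  have hne : ∀ p ∈ l, ω (b - a) (p - a) ≠ 0 := fun p hp =>
    areaForm_ne_zero_of_convexIndependent h.convexIndependent (by simp) (by simp) (by simp [hp]) hab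
      (fun hap => hal (hap ▸ hp)) (fun hbp => hbl (hbp ▸ hp))
  refine mul_pos_of_forall_mul_pos hne ?_
  rintro X c d Y rfl
  by_contra! hle
  have hneg := hle.lt_of_ne (mul_ne_zero (hne c (by simp)) (hne d (by simp)))
  simp only [List.mem_append, List.mem_cons, not_or] at hal hbl
  have hlt := dist_add_dist_lt_of_areaForm_mul_neg
    (notMem_convexHull_of_convexIndependent h.convexIndependent (x := a) (by simp) (by
      rintro x (rfl | rfl | rfl) <;> grind))
    (notMem_convexHull_of_convexIndependent h.convexIndependent (x := b) (by simp) (by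
      rintro x (rfl | rfl | rfl) <;> grind)) hneg
  have hperm : (a :: c :: X.reverse ++ b :: d :: Y).Perm (a :: b :: X ++ c :: d :: Y) := by
    grind
  have hle := h.le_of_perm _ hperm
  have := tourSum_dist_two_opt a b c d X Y
  simp only [List.cons_append] at *
  linarith

end ShortestTour

section ConvexTour

theorem exists_rotate_eq_of_mem_tourEdges {α : Type*} {l : List α} {e : α × α}
    (he : e ∈ tourEdges l) :
    l = [e.1] ∧ e.2 = e.1 ∨ ∃ n l', l.rotate n = e.1 :: e.2 :: l' := by
  obtain ⟨n, hn, rfl⟩ := List.mem_iff_getElem.1 he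
  have hlen : n < l.length := by simpa [tourEdges] using hn
  simp only [tourEdges, List.getElem_zip, List.getElem_rotate]
  rcases l with _ | ⟨a, _ | ⟨b, l⟩⟩
  · simp at hlen
  · exact Or.inl (by simp)
  right
  obtain ⟨c, d, l', hl'⟩ : ∃ c d l', (a :: b :: l).rotate n = c :: d :: l' := by
    have hrot : 2 ≤ ((a :: b :: l).rotate n).length := by simp
    generalize (a :: b :: l).rotate n = r at hrot ⊢
    rcases r with _ | ⟨c, _ | ⟨d, l'⟩⟩
    · simp at hrot
    · simp at hrot
    · exact ⟨c, d, l', rfl⟩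
  have hfst := List.getElem_rotate (a :: b :: l) n 0 (by simp)
  have hsnd := List.getElem_rotate (a :: b :: l) n 1 (by simp)
  simp only [hl', zero_add, Nat.mod_eq_of_lt hlen, List.getElem_cons_zero,
    List.getElem_cons_succ] at hfst hsnd
  exact ⟨n, l', by simp only [hl', hfst, hsnd, add_comm n 1]⟩

/-- All the other points of the tour lie strictly to the left of its first edge. -/
def LeftOfFirstEdge (l : List ℂ) : Prop :=
  ∀ a b l', l = a :: b :: l' → ∀ p ∈ l', 0 < ω (b - a) (p - a)

/-- A tour without repetitions such that, for each of its edges, all the points other than the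
endpoints of the edge lie strictly to its left. -/
structure IsConvexTour (l : List ℂ) : Prop where
  nodup : l.Nodup
  areaForm_pos : ∀ e ∈ tourEdges l, ∀ x ∈ l, x ≠ e.1 → x ≠ e.2 → 0 < ω (e.2 - e.1) (x - e.1)

theorem IsShortestTour.leftOfFirstEdge_rotate_one {l : List ℂ} (h : IsShortestTour l)
    (hl : LeftOfFirstEdge l) : LeftOfFirstEdge (l.rotate 1) := by
  rcases l with _ | ⟨a, _ | ⟨b, _ | ⟨c, l⟩⟩⟩
  · exact hl
  · rwa [List.rotate_singleton]
  · rintro a' b' l' heq p hp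
    obtain ⟨-, -, rfl⟩ : b = a' ∧ a = b' ∧ [] = l' := by simpa using heq
    exact absurd hp List.not_mem_nil
  rintro b' c' l' heq p hp
  obtain ⟨rfl, rfl, rfl⟩ : b = b' ∧ c = c' ∧ l ++ [a] = l' := by simpa using heq
  have hleft : 0 < ω (c - b) (a - b) :=
    areaForm_sub_sub_rotate a b c ▸ hl a b (c :: l) rfl c (by simp)
  have hside := (h.rotate 1 : IsShortestTour (b :: c :: (l ++ [a]))).areaForm_mul_pos
  exact pos_of_mul_pos_left (hside p hp a (by simp)) hleft.le

theorem IsShortestTour.leftOfFirstEdge_rotate {l : List ℂ} (h : IsShortestTour l)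
    (hl : LeftOfFirstEdge l) (n : ℕ) : LeftOfFirstEdge (l.rotate n) := by
  induction n with
  | zero => rwa [List.rotate_zero]
  | succ n ih =>
    rw [← List.rotate_rotate]
    exact (h.rotate n).leftOfFirstEdge_rotate_one ih

theorem IsShortestTour.isConvexTour {l : List ℂ} (h : IsShortestTour l)
    (hl : LeftOfFirstEdge l) : IsConvexTour l := by
  refine ⟨h.nodup, fun e he x hx hx₁ hx₂ => ?_⟩
  rcases exists_rotate_eq_of_mem_tourEdges he with ⟨hsingle, -⟩ | ⟨n, l', hn⟩
  · exact absurd (List.mem_singleton.1 (hsingle ▸ hx)) hx₁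
  have hxn : x ∈ e.1 :: e.2 :: l' := hn ▸ List.mem_rotate.2 hx
  simp only [List.mem_cons, hx₁, hx₂, false_or] at hxn
  exact h.leftOfFirstEdge_rotate hl n _ _ _ hn x hxn

theorem IsShortestTour.exists_perm_leftOfFirstEdge {l : List ℂ} (h : IsShortestTour l) :
    ∃ l' : List ℂ, l'.Perm l ∧ IsShortestTour l' ∧ LeftOfFirstEdge l' := by
  by_cases hl : LeftOfFirstEdge l
  · exact ⟨l, List.Perm.refl l, h, hl⟩
  unfold LeftOfFirstEdge at hl
  push Not at hl
  obtain ⟨a, b, l', rfl, p, hp, hle⟩ := hl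
  have hrot : (a :: b :: l').reverse.rotate l'.length = b :: a :: l'.reverse := by
    rw [← l'.length_reverse, List.reverse_cons, List.reverse_cons, List.append_assoc,
      List.rotate_append_length_eq]
    rfl
  refine ⟨b :: a :: l'.reverse, ?_, hrot ▸ h.reverse.rotate _, ?_⟩
  · exact (List.Perm.swap a b _).trans (((l'.reverse_perm).cons b).cons a)
  rintro b' a' l'' heq q hq
  obtain ⟨rfl, rfl, rfl⟩ : b = b' ∧ a = a' ∧ l'.reverse = l'' := by simpa using heq
  have hneg := neg_of_mul_pos_right (h.areaForm_mul_pos p hp q (List.mem_reverse.1 hq)) hle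
  rwa [Orientation.areaForm_swap, areaForm_sub_sub_rotate, Left.neg_pos_iff]

theorem exists_isConvexTour (l : List ℂ) :
    ∃ l' : List ℂ, l' ⊆ l ∧ l'.length ≤ l.length ∧ tourSum dist l' ≤ tourSum dist l ∧
      (∀ x ∈ l, x ∈ convexHull ℝ {y | y ∈ l'}) ∧ IsConvexTour l' := by
  obtain ⟨l₁, hsub, hnodup, hindep, hhull⟩ := exists_convexIndependent_sublist l
  obtain ⟨l₂, hperm₂, hshort₂⟩ := exists_isShortestTour l₁ hnodup hindep
  obtain ⟨l₃, hperm₃, hshort₃, hleft⟩ := hshort₂.exists_perm_leftOfFirstEdge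
  have hperm := hperm₃.trans hperm₂
  have hset : {y | y ∈ l₃} = {y | y ∈ l₁} := Set.ext fun _ => hperm.mem_iff
  refine ⟨l₃, fun x hx => hsub.subset (hperm.subset hx),
    hperm.length_eq.trans_le hsub.length_le, ?_, hset ▸ hhull, hshort₃.isConvexTour hleft⟩
  exact (hshort₃.le_of_perm l₁ hperm.symm).trans (tourSum_dist_le_of_sublist hsub)

end ConvexTour

/-! ### The area of the convex hull of a closed polygon -/

section HullArea

open MeasureTheory

/-- The triangle with vertices `a`, `p` and `q`. -/
def triangle (a p q : ℂ) : Set ℂ :=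
  {x | ∃ s t : ℝ, 0 ≤ s ∧ 0 ≤ t ∧ s + t ≤ 1 ∧ x = a + (s • (p - a) + t • (q - a))}

theorem volume_standardTriangle :
    volume {p : ℝ × ℝ | 0 ≤ p.1 ∧ 0 ≤ p.2 ∧ p.1 + p.2 ≤ 1} = ENNReal.ofReal (1 / 2) := by
  set T : Set (ℝ × ℝ) := {p | 0 ≤ p.1 ∧ 0 ≤ p.2 ∧ p.1 + p.2 ≤ 1}
  have hclosed : IsClosed T :=
    (isClosed_le continuous_const continuous_fst).inter
      ((isClosed_le continuous_const continuous_snd).inter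
        (isClosed_le (continuous_fst.add continuous_snd) continuous_const))
  have hsection (x : ℝ) : volume (Prod.mk x ⁻¹' T) =
      (Set.Icc (0 : ℝ) 1).indicator (fun x => ENNReal.ofReal (1 - x)) x := by
    by_cases hx : x ∈ Set.Icc (0 : ℝ) 1
    · have hIcc : Prod.mk x ⁻¹' T = Set.Icc 0 (1 - x) := by
        ext y
        exact ⟨fun h => ⟨h.2.1, le_sub_iff_add_le'.2 h.2.2⟩,
          fun h => ⟨hx.1, h.1, le_sub_iff_add_le'.1 h.2⟩⟩
      rw [Set.indicator_of_mem hx, hIcc, Real.volume_Icc, sub_zero]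
    · have hempty : Prod.mk x ⁻¹' T = ∅ := Set.eq_empty_of_forall_notMem fun y hy =>
        hx ⟨hy.1, (le_add_of_nonneg_right hy.2.1).trans hy.2.2⟩
      rw [Set.indicator_of_notMem hx, hempty, measure_empty]
  rw [Measure.volume_eq_prod, Measure.prod_apply hclosed.measurableSet, lintegral_congr hsection,
    lintegral_indicator measurableSet_Icc, ← ofReal_integral_eq_lintegral_ofReal]
  · rw [integral_Icc_eq_integral_Ioc, ← intervalIntegral.integral_of_le zero_le_one,
      intervalIntegral.integral_sub (by simp) (by simp), integral_id]
    norm_num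
  · exact (by fun_prop : Continuous fun x : ℝ => 1 - x).continuousOn.integrableOn_Icc
  · filter_upwards [ae_restrict_mem measurableSet_Icc] with x hx
    exact sub_nonneg.2 hx.2

theorem volume_triangle (a p q : ℂ) :
    volume (triangle a p q) = ENNReal.ofReal (|ω (p - a) (q - a)| / 2) := by
  set T : Set ℂ := {z | 0 ≤ z.re ∧ 0 ≤ z.im ∧ z.re + z.im ≤ 1}
  have hT : volume T = ENNReal.ofReal (1 / 2) := by
    rw [← volume_standardTriangle,
      ← Complex.volume_preserving_equiv_real_prod.measure_preimage_equiv]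
    rfl
  let L : ℂ →ₗ[ℝ] ℂ := Complex.reLm.smulRight (p - a) + Complex.imLm.smulRight (q - a)
  have hdet : LinearMap.det L = ω (p - a) (q - a) := by
    rw [← LinearMap.det_toMatrix Complex.basisOneI, Matrix.det_fin_two, areaForm_eq]
    simp [LinearMap.toMatrix_apply, L]
    ring
  have himage : triangle a p q = (fun x => a + x) '' (L '' T) := by
    ext x
    constructor
    · rintro ⟨s, t, hs, ht, hst, rfl⟩
      exact ⟨_, ⟨⟨s, t⟩, ⟨hs, ht, hst⟩, rfl⟩, rfl⟩
    · rintro ⟨-, ⟨z, ⟨hs, ht, hst⟩, rfl⟩, rfl⟩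
      exact ⟨z.re, z.im, hs, ht, hst, rfl⟩
  rw [himage, Set.image_add_left, measure_preimage_add, Measure.addHaar_image_linearMap, hT, hdet,
    ← ENNReal.ofReal_mul (abs_nonneg _), mul_one_div]

theorem mem_triangle {a p q x : ℂ} (hpq : 0 < ω (p - a) (q - a)) (hp : 0 ≤ ω (p - a) (x - a))
    (hq : 0 ≤ ω (x - a) (q - a)) (hx : 0 ≤ ω (q - p) (x - p)) : x ∈ triangle a p q := by
  have hsum : ω (q - p) (x - p) = ω (p - a) (q - a) - ω (x - a) (q - a) - ω (p - a) (x - a) := by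
    simp only [areaForm_eq, Complex.sub_re, Complex.sub_im]
    ring
  have hcramer : ω (p - a) (q - a) • (x - a) =
      ω (x - a) (q - a) • (p - a) + ω (p - a) (x - a) • (q - a) := by
    simp only [areaForm_eq, Complex.ext_iff, Complex.real_smul, Complex.add_re, Complex.add_im,
      Complex.re_ofReal_mul, Complex.im_ofReal_mul, Complex.sub_re, Complex.sub_im]
    constructor <;> ring
  refine ⟨ω (x - a) (q - a) / ω (p - a) (q - a), ω (p - a) (x - a) / ω (p - a) (q - a),
    div_nonneg hq hpq.le, div_nonneg hp hpq.le, ?_, ?_⟩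
  · rw [← add_div, div_le_one hpq]
    linarith
  · rw [← sub_eq_iff_eq_add', div_eq_inv_mul, div_eq_inv_mul, mul_smul, mul_smul, ← smul_add,
      ← hcramer, inv_smul_smul₀ hpq.ne']

theorem exists_mem_pathEdges_sign_change {α : Type*} (s : α → ℝ) {a x : α} {l : List α}
    (ha : 0 ≤ s a) (hx : s x ≤ 0) : ∃ e ∈ pathEdges a l x, 0 ≤ s e.1 ∧ s e.2 ≤ 0 := by
  induction l generalizing a with
  | nil => exact ⟨(a, x), by simp [pathEdges], ha, hx⟩
  | cons b l ih =>
    rcases le_total (s b) 0 with hb | hb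
    · exact ⟨(a, b), by simp [pathEdges], ha, hb⟩
    · obtain ⟨e, he, hs⟩ := ih hb
      exact ⟨e, List.mem_cons_of_mem _ he, hs⟩

theorem measureReal_biUnion_list_le {α ι : Type*} [MeasurableSpace α] (μ : Measure α)
    (T : ι → Set α) (l : List ι) : μ.real (⋃ i ∈ l, T i) ≤ (l.map fun i => μ.real (T i)).sum := by
  induction l with
  | nil => simp
  | cons i l ih =>
    simp only [List.mem_cons, Set.iUnion_iUnion_eq_or_left, List.map_cons, List.sum_cons]
    exact (measureReal_union_le _ _).trans (by gcongr)

theorem areaForm_sub_nonneg_of_mem_convexHull {s : Set ℂ} {u p x : ℂ}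
    (h : ∀ y ∈ s, 0 ≤ ω u (y - p)) (hx : x ∈ convexHull ℝ s) : 0 ≤ ω u (x - p) := by
  have hhull : convexHull ℝ s ⊆ {y | ω u p ≤ ω u y} :=
    convexHull_min (fun y hy => sub_nonneg.1 (map_sub (ω u) y p ▸ h y hy))
      (convex_halfSpace_ge (ω u).isLinear _)
  exact map_sub (ω u) x p ▸ sub_nonneg.2 (hhull hx)

theorem IsConvexTour.areaForm_nonneg_of_mem_convexHull {l : List ℂ} (h : IsConvexTour l)
    {e : ℂ × ℂ} (he : e ∈ tourEdges l) {x : ℂ} (hx : x ∈ convexHull ℝ {y | y ∈ l}) :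
    0 ≤ ω (e.2 - e.1) (x - e.1) := by
  refine areaForm_sub_nonneg_of_mem_convexHull (fun y hy => ?_) hx
  rcases eq_or_ne y e.1 with rfl | h₁
  · rw [sub_self, map_zero]
  rcases eq_or_ne y e.2 with rfl | h₂
  · rw [Orientation.areaForm_apply_self]
  exact (h.areaForm_pos e he y hy h₁ h₂).le

theorem tourEdges_cons_cons_append_singleton {α : Type*} (a b d : α) (l : List α) :
    tourEdges (a :: b :: (l ++ [d])) = (a, b) :: (pathEdges b l d ++ [(d, a)]) := by
  simp only [tourEdges, pathEdges, List.rotate_cons_succ, List.rotate_zero, List.cons_append,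
    List.zip_cons_cons]
  rw [← List.cons_append, List.zip_append (by simp)]
  rfl

-- The rays from `a` through the other points divide the hull into a fan of triangles.
theorem IsConvexTour.exists_mem_triangle {a b d x : ℂ} {l : List ℂ}
    (h : IsConvexTour (a :: b :: (l ++ [d])))
    (hx : x ∈ convexHull ℝ {y | y ∈ a :: b :: (l ++ [d])}) :
    ∃ e ∈ pathEdges b l d, x ∈ triangle a e.1 e.2 := by
  have htour := tourEdges_cons_cons_append_singleton a b d l
  have hfirst : 0 ≤ ω (b - a) (x - a) :=
    h.areaForm_nonneg_of_mem_convexHull (e := (a, b)) (by simp [htour]) hx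
  have hlast : ω (d - a) (x - a) ≤ 0 := by
    rw [Orientation.areaForm_swap, neg_nonpos, ← areaForm_sub_sub_rotate, ← areaForm_sub_sub_rotate]
    exact h.areaForm_nonneg_of_mem_convexHull (e := (d, a)) (by simp [htour]) hx
  obtain ⟨e, he, hfst, hsnd⟩ :=
    exists_mem_pathEdges_sign_change (l := l) (fun y => ω (y - a) (x - a)) hfirst hlast
  have hmem : e ∈ tourEdges (a :: b :: (l ++ [d])) := by simp [htour, he]
  have ha : a ∉ b :: (l ++ [d]) := (List.nodup_cons.1 h.nodup).1
  obtain ⟨h₁, h₂⟩ := List.of_mem_zip he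
  have hpos : 0 < ω (e.1 - a) (e.2 - a) := areaForm_sub_sub_rotate a e.1 e.2 ▸
    h.areaForm_pos e hmem a List.mem_cons_self
      (fun h => ha (h ▸ List.mem_append_left [d] h₁))
      (fun h => ha (h ▸ List.mem_cons_of_mem _ h₂))
  refine ⟨e, he, mem_triangle hpos hfst ?_ (h.areaForm_nonneg_of_mem_convexHull hmem hx)⟩
  rw [Orientation.areaForm_swap]
  exact neg_nonneg.2 hsnd

theorem IsConvexTour.volume_convexHull_le_of_three_le {a b d : ℂ} {l : List ℂ}
    (h : IsConvexTour (a :: b :: (l ++ [d]))) :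
    volume.real (convexHull ℝ {y | y ∈ a :: b :: (l ++ [d])}) ≤
      tourSum (fun p q => ω (p - a) (q - a)) (a :: b :: (l ++ [d])) / 2 := by
  have hpos : ∀ e ∈ pathEdges b l d, 0 ≤ ω (e.1 - a) (e.2 - a) := fun e he => by
    rw [← areaForm_sub_sub_rotate]
    exact h.areaForm_nonneg_of_mem_convexHull
      (by simp [tourEdges_cons_cons_append_singleton, he]) (subset_convexHull ℝ _ (by simp))
  have hvol : ∀ e ∈ pathEdges b l d,
      volume.real (triangle a e.1 e.2) = ω (e.1 - a) (e.2 - a) / 2 := fun e he => by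
    rw [measureReal_def, volume_triangle, ENNReal.toReal_ofReal (by positivity),
      abs_of_nonneg (hpos e he)]
  calc volume.real (convexHull ℝ {y | y ∈ a :: b :: (l ++ [d])})
      ≤ volume.real (⋃ e ∈ pathEdges b l d, triangle a e.1 e.2) := by
        refine measureReal_mono (fun x hx => ?_) ?_
        · simpa using h.exists_mem_triangle hx
        · exact (measure_biUnion_lt_top (pathEdges b l d).finite_toSet
            fun e _ => volume_triangle a e.1 e.2 ▸ ENNReal.ofReal_lt_top).ne
    _ ≤ ((pathEdges b l d).map fun e => ω (e.1 - a) (e.2 - a) / 2).sum :=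
        (measureReal_biUnion_list_le _ _ _).trans_eq (by rw [List.map_congr_left hvol])
    _ = tourSum (fun p q => ω (p - a) (q - a)) (a :: b :: (l ++ [d])) / 2 := by
        simp [tourSum, tourEdges_cons_cons_append_singleton, div_eq_mul_inv,
          List.sum_map_mul_right]

theorem segment_subset_triangle (a b : ℂ) : segment ℝ a b ⊆ triangle a b b := by
  rintro x hx
  rw [segment_eq_image'] at hx
  obtain ⟨t, ⟨ht₀, ht₁⟩, rfl⟩ := hx
  exact ⟨t, 0, ht₀, le_rfl, by linarith, by simp⟩

theorem volume_segment (a b : ℂ) : volume (segment ℝ a b) = 0 :=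
  measure_mono_null (segment_subset_triangle a b)
    (by rw [volume_triangle, Orientation.areaForm_apply_self]; simp)

theorem IsConvexTour.volume_convexHull_le {a : ℂ} {l : List ℂ} (h : IsConvexTour (a :: l)) :
    volume.real (convexHull ℝ {y | y ∈ a :: l}) ≤
      tourSum (fun p q => ω (p - a) (q - a)) (a :: l) / 2 := by
  rcases l with _ | ⟨b, l⟩
  · simp [measureReal_def, tourSum_cons, pathSum_nil]
  rcases List.eq_nil_or_concat' l with rfl | ⟨l, d, rfl⟩
  · have hpair : {y | y ∈ [a, b]} = {a, b} := by ext; simp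
    rw [hpair, convexHull_pair, measureReal_def, volume_segment]
    simp [tourSum_cons, pathSum_nil, pathSum_cons]
  · exact h.volume_convexHull_le_of_three_le

theorem exists_range_eq_mem_list {m : ℕ} [NeZero m] {α : Type*} {a : α} {l : List α}
    (hl : (a :: l).length ≤ m) :
    ∃ w : ZMod m → α, Set.range w = {x | x ∈ a :: l} ∧ ∀ f : α → α → ℝ, (∀ x, f x x = 0) →
      ∑ k, f (w k) (w (k + 1)) = tourSum f (a :: l) := by
  -- Repeating the first entry changes none of these sums.
  set l' : List α := List.replicate (m - (a :: l).length) a ++ a :: l with hl'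
  have hlen : l'.length = m := by
    rw [hl', List.length_append, List.length_replicate, Nat.sub_add_cancel hl]
  refine ⟨fun k => l'[k.val]'(hlen.symm ▸ ZMod.val_lt k), ?_, fun f hf => ?_⟩
  · ext x
    have hmem : x ∈ l' ↔ x ∈ a :: l := by
      simp +contextual [hl', List.mem_replicate]
    rw [Set.mem_ofPred_eq, ← hmem]
    constructor
    · rintro ⟨k, rfl⟩
      exact List.getElem_mem _
    · intro hx
      obtain ⟨n, hn, rfl⟩ := List.mem_iff_getElem.1 hx
      exact ⟨n, by simp only [ZMod.val_natCast_of_lt (hlen ▸ hn)]⟩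
  · rw [← tourSum_replicate_append hf a l (m - (a :: l).length)]
    exact (tourSum_eq_sum f l' hlen fun _ => rfl).symm

theorem exists_volume_convexHull_le {m : ℕ} [NeZero m] (v : ZMod m → ℂ) :
    ∃ w : ZMod m → ℂ, Set.range w ⊆ Set.range v ∧ closedLength w ≤ closedLength v ∧
      volume.real (convexHull ℝ (Set.range v)) ≤ signedArea w := by
  set l : List ℂ := List.ofFn fun i : Fin m => v (i : ℕ) with hl
  have hlen : l.length = m := List.length_ofFn
  have hv (k : ZMod m) : v k = l[k.val]'(hlen.symm ▸ ZMod.val_lt k) := by simp [hl]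
  have hrange : {y | y ∈ l} = Set.range v := by
    ext x
    refine ⟨fun hx => ?_, ?_⟩
    · obtain ⟨i, rfl⟩ := List.mem_ofFn.1 hx
      exact ⟨_, rfl⟩
    · rintro ⟨k, rfl⟩
      exact (hv k).symm ▸ List.getElem_mem _
  obtain ⟨l', hsub, hlen', hlength, hhull, hconvex⟩ := exists_isConvexTour l
  rcases l' with _ | ⟨a, l'⟩
  · have := hhull (v 0) ((hv 0).symm ▸ List.getElem_mem _)
    simp at this
  obtain ⟨w, hw, hsum⟩ := exists_range_eq_mem_list (m := m) (hlen'.trans_eq hlen)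
  refine ⟨w, ?_, ?_, ?_⟩
  · rw [hw, ← hrange]
    exact hsub
  · rwa [closedLength, closedLength, hsum dist dist_self, ← tourSum_eq_sum dist l hlen hv]
  · have hle : convexHull ℝ (Set.range v) ⊆ convexHull ℝ {y | y ∈ a :: l'} :=
      convexHull_min (hrange ▸ hhull) (convex_convexHull ℝ _)
    have hfin := ((a :: l').finite_toSet.isCompact_convexHull ℝ).measure_lt_top (μ := volume)
    rw [← signedArea_sub_const w a, signedArea, hsum (fun p q => ω (p - a) (q - a))
      fun x => Orientation.areaForm_apply_self _ _]
    exact (measureReal_mono hle hfin.ne).trans hconvex.volume_convexHull_le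

end HullArea

/-! ### The equality case for convex hulls -/

section HullEquality

open MeasureTheory ZMod

theorem exists_perm_eq_comp {ι α : Type*} [Finite ι] {v w : ι → α} (hw : Function.Injective w)
    (h : Set.range w ⊆ Set.range v) : ∃ σ : Equiv.Perm ι, v = w ∘ σ := by
  choose τ hτ using fun k => h (Set.mem_range_self k)
  have hτinj : Function.Injective τ := fun i j hij => hw (by rw [← hτ i, ← hτ j, hij])
  let e := Equiv.ofBijective τ (Finite.injective_iff_bijective.1 hτinj)
  have hve : v ∘ e = w := funext hτ
  exact ⟨e.symm, (Equiv.eq_comp_symm e v w).2 hve⟩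

variable {m : ℕ}

theorem eq_add_or_eq_sub_of_forall_step (hm : 3 ≤ m) {σ : ZMod m → ZMod m}
    (hσ : Function.Injective σ) (hstep : ∀ k, σ (k + 1) - σ k = 1 ∨ σ (k + 1) - σ k = -1) :
    (∀ k, σ k = σ 0 + k) ∨ ∀ k, σ k = σ 0 - k := by
  have : NeZero m := ⟨by omega⟩
  have htwo (k : ZMod m) : k + 1 + 1 ≠ k := fun h => by
    have h2 : ((2 : ℕ) : ZMod m) = 0 := by
      push_cast
      linear_combination h
    rw [ZMod.natCast_eq_zero_iff] at h2
    exact absurd (Nat.le_of_dvd two_pos h2) (by omega)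
  have hconst (k : ZMod m) : σ (k + 1 + 1) - σ (k + 1) = σ (k + 1) - σ k := by
    have hne : σ (k + 1 + 1) ≠ σ k := hσ.ne (htwo k)
    rcases hstep k with h₁ | h₁ <;> rcases hstep (k + 1) with h₂ | h₂
    · rw [h₁, h₂]
    · exact absurd (by linear_combination h₁ + h₂) hne
    · exact absurd (by linear_combination h₁ + h₂) hne
    · rw [h₁, h₂]
  have hall (n : ℕ) : σ (n + 1) - σ n = σ (0 + 1) - σ 0 := by
    induction n with
    | zero => rw [Nat.cast_zero]
    | succ n ih => rw [← ih, Nat.cast_succ, hconst]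
  have hmul (n : ℕ) : σ n = σ 0 + n * (σ (0 + 1) - σ 0) := by
    induction n with
    | zero => simp
    | succ n ih =>
      push_cast
      linear_combination ih + hall n
  refine (hstep 0).imp (fun h k => ?_) fun h k => ?_ <;>
  · have := hmul k.val
    rw [h, ZMod.natCast_zmod_val] at this
    linear_combination this

variable [NeZero m]

theorem sin_lt_sin_of_lt_of_add_lt_pi {x y : ℝ} (hx : 0 < x) (hxy : x < y)
    (hsum : x + y < Real.pi) : Real.sin x < Real.sin y := by
  rw [← sub_pos, Real.sin_sub_sin]
  have hsin := Real.sin_pos_of_pos_of_lt_pi (x := (y - x) / 2) (by linarith) (by linarith)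
  have hcos := Real.cos_pos_of_mem_Ioo (x := (y + x) / 2) ⟨by linarith, by linarith⟩
  positivity

theorem norm_stdAddChar_one_sub_one_lt {j : ZMod m} (h0 : j ≠ 0) (h1 : j ≠ 1) (hneg : j ≠ -1) :
    ‖(stdAddChar (1 : ZMod m) : ℂ) - 1‖ < ‖(stdAddChar j : ℂ) - 1‖ := by
  have hm : 1 < m := by
    by_contra! hle
    obtain rfl : m = 1 := le_antisymm hle (NeZero.pos m)
    exact h0 (Subsingleton.elim _ _)
  have : Fact (1 < m) := ⟨hm⟩
  have hval0 : j.val ≠ 0 := (ZMod.val_ne_zero j).2 h0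
  have hval1 : j.val ≠ 1 := fun h => h1 (ZMod.val_injective m (h.trans (ZMod.val_one m).symm))
  have hvalneg : j.val + 1 ≠ m := fun h => hneg <| by
    have hcast : ((j.val + 1 : ℕ) : ZMod m) = 0 := by rw [h, ZMod.natCast_self]
    rw [Nat.cast_succ, ZMod.natCast_zmod_val] at hcast
    exact eq_neg_of_add_eq_zero_left hcast
  have hlt : (1 : ℝ) < j.val := by exact_mod_cast (by omega : 1 < j.val)
  have hsum : (1 : ℝ) + j.val < m := by
    have := ZMod.val_lt j
    exact_mod_cast (by omega : 1 + j.val < m)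
  have hpi : 0 < Real.pi / m := by positivity
  rw [norm_stdAddChar_sub_one, norm_stdAddChar_sub_one, ZMod.val_one, Nat.cast_one,
    mul_div_right_comm, mul_div_right_comm]
  gcongr
  refine sin_lt_sin_of_lt_of_add_lt_pi (by linarith) (by gcongr) ?_
  calc Real.pi / m * 1 + Real.pi / m * j.val = Real.pi / m * (1 + j.val) := by ring
    _ < Real.pi / m * m := by gcongr
    _ = Real.pi := div_mul_cancel₀ _ (NeZero.ne _)

theorem norm_stdAddChar_one_sub_one_le {j : ZMod m} (h0 : j ≠ 0) :
    ‖(stdAddChar (1 : ZMod m) : ℂ) - 1‖ ≤ ‖(stdAddChar j : ℂ) - 1‖ := by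
  rcases eq_or_ne j 1 with rfl | h1
  · exact le_rfl
  rcases eq_or_ne j (-1) with rfl | hneg
  · have hconj : (stdAddChar (-1 : ZMod m) : ℂ) - 1 = conj (stdAddChar (1 : ZMod m) - 1 : ℂ) := by
      rw [AddChar.map_neg_eq_conj, map_sub, map_one (starRingEnd ℂ)]
    rw [hconj, Complex.norm_conj]
  exact (norm_stdAddChar_one_sub_one_lt h0 h1 hneg).le

theorem dist_regularVertices (c b : ℂ) (i j : ZMod m) :
    dist (regularVertices c b i) (regularVertices c b j) =
      ‖b‖ * ‖(stdAddChar (j - i) : ℂ) - 1‖ := by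
  have hdiff : regularVertices c b j - regularVertices c b i =
      b * (stdAddChar i * (stdAddChar (j - i) - 1)) := by
    rw [mul_sub (stdAddChar i : ℂ), ← AddChar.map_add_eq_mul, add_sub_cancel, regularVertices,
      regularVertices]
    ring
  rw [dist_comm, dist_eq_norm, hdiff, norm_mul, norm_mul, AddChar.norm_apply, one_mul]

theorem closedLength_regularVertices (c b : ℂ) :
    closedLength (regularVertices (m := m) c b) =
      m * (‖b‖ * ‖(stdAddChar (1 : ZMod m) : ℂ) - 1‖) := by
  simp only [closedLength, dist_regularVertices, add_sub_cancel_left, sum_const, card_univ,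
    ZMod.card, nsmul_eq_mul]

theorem regularVertices_injective (c : ℂ) {b : ℂ} (hb : b ≠ 0) :
    Function.Injective (regularVertices (m := m) c b) := fun _ _ h =>
  injective_stdAddChar (mul_left_cancel₀ hb (add_left_cancel h))

-- A side is the shortest chord, so a tour of the same length uses only sides.
theorem step_eq_of_closedLength_regularVertices_comp {c b : ℂ} (hb : b ≠ 0)
    {σ : Equiv.Perm (ZMod m)}
    (h : closedLength (regularVertices c b ∘ σ) = closedLength (regularVertices (m := m) c b))
    (k : ZMod m) : σ (k + 1) - σ k = 1 ∨ σ (k + 1) - σ k = -1 := by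
  by_contra! hne
  have : Nontrivial (ZMod m) := ⟨_, _, hne.1⟩
  have hstep (j : ZMod m) : σ (j + 1) - σ j ≠ 0 := sub_ne_zero.2 (σ.injective.ne (by simp))
  refine h.not_gt ?_
  simp only [closedLength, Function.comp_apply, dist_regularVertices, add_sub_cancel_left]
  refine sum_lt_sum (fun j _ => ?_) ⟨k, mem_univ k, ?_⟩
  · exact mul_le_mul_of_nonneg_left (norm_stdAddChar_one_sub_one_le (hstep j)) (norm_nonneg b)
  · exact mul_lt_mul_of_pos_left (norm_stdAddChar_one_sub_one_lt (hstep k) hne.1 hne.2)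
      (norm_pos_iff.2 hb)

theorem four_mul_rho_mul_volume_convexHull_le (hm : 3 ≤ m) (v : ZMod m → ℂ) :
    4 * rho m * volume.real (convexHull ℝ (Set.range v)) ≤ closedLength v ^ 2 := by
  obtain ⟨w, -, hlength, hvolume⟩ := exists_volume_convexHull_le v
  have hρ := rho_pos hm
  calc 4 * rho m * volume.real (convexHull ℝ (Set.range v))
      ≤ 4 * rho m * signedArea w := by gcongr
    _ ≤ closedLength w ^ 2 := four_mul_rho_mul_signedArea_le hm w
    _ ≤ closedLength v ^ 2 := pow_le_pow_left₀ (closedLength_nonneg w) hlength 2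

theorem eq_regularVertices_of_volume_convexHull_eq (hm : 3 ≤ m) {v : ZMod m → ℂ}
    (hv : 0 < closedLength v)
    (h : 4 * rho m * volume.real (convexHull ℝ (Set.range v)) = closedLength v ^ 2) :
    ∃ c b, v = regularVertices c b ∨ v = fun k => regularVertices c b (-k) := by
  obtain ⟨w, hrange, hlength, hvolume⟩ := exists_volume_convexHull_le v
  have hρ := rho_pos hm
  have harea : closedLength v ^ 2 ≤ 4 * rho m * signedArea w := by
    rw [← h]
    gcongr
  have hisop := four_mul_rho_mul_signedArea_le hm w
  have hlen : closedLength v = closedLength w :=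
    le_antisymm (le_of_sq_le_sq (harea.trans hisop) (closedLength_nonneg w)) hlength
  obtain ⟨c, b, rfl⟩ := eq_regularVertices_of_signedArea_eq hm
    (hisop.antisymm (hlen ▸ harea))
  have hb : b ≠ 0 := by
    rintro rfl
    simp [hlen, closedLength_regularVertices] at hv
  obtain ⟨σ, rfl⟩ := exists_perm_eq_comp (regularVertices_injective c hb) hrange
  have hshift (s t : ZMod m) :
      regularVertices c b (s + t) = regularVertices c (b * stdAddChar s) t := by
    rw [regularVertices, regularVertices, AddChar.map_add_eq_mul, mul_assoc]
  refine ⟨c, b * stdAddChar (σ 0), (eq_add_or_eq_sub_of_forall_step hm σ.injective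
    (step_eq_of_closedLength_regularVertices_comp hb hlen)).imp ?_ ?_⟩ <;>
    refine fun hσ => funext fun k => ?_
  · rw [Function.comp_apply, hσ, hshift]
  · rw [Function.comp_apply, hσ, sub_eq_add_neg, hshift]

end HullEquality

/-! ### Polygons in the Euclidean plane -/

section EnclosedRegion

open MeasureTheory

-- From a point outside `K`, the ray pointing away from a point of `C` never meets the half-plane
-- that separates `K` from it, so the component of the point in the complement is unbounded.
theorem enclosedRegion_subset {C K : Set Plane} (hC : C.Nonempty) (hCK : C ⊆ K)
    (hK : Convex ℝ K) (hK' : IsClosed K) : enclosedRegion C ⊆ K := by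
  rintro x (hx | ⟨-, hbdd⟩)
  · exact hCK hx
  by_contra hxK
  obtain ⟨f, u, hf, hu⟩ := geometric_hahn_banach_closed_point hK hK' hxK
  obtain ⟨a, ha⟩ := hC
  have hdir : 0 < f (x - a) := by
    rw [map_sub]
    exact sub_pos.2 ((hf a (hCK ha)).trans hu)
  have hnorm : 0 < ‖x - a‖ := norm_pos_iff.2 fun h => by simp [h] at hdir
  let R : Set Plane := (fun t : ℝ => x + t • (x - a)) '' Set.Ici 0
  have hR : IsPreconnected R := isPreconnected_Ici.image _ (by fun_prop)
  have hRC : R ⊆ Cᶜ := by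
    rintro _ ⟨t, ht, rfl⟩ hmem
    have hlt := hf _ (hCK hmem)
    have hnonneg := mul_nonneg (Set.mem_Ici.1 ht) hdir.le
    rw [map_add, map_smul, smul_eq_mul] at hlt
    linarith
  have hxR : x ∈ R := ⟨0, Set.self_mem_Ici, by simp⟩
  obtain ⟨r, hr⟩ := (hbdd.subset (hR.subset_connectedComponentIn hxR hRC)).subset_closedBall x
  have hmem := hr ⟨(|r| + 1) / ‖x - a‖, Set.mem_Ici.2 (by positivity), rfl⟩
  rw [Metric.mem_closedBall, dist_self_add_left, norm_smul, Real.norm_of_nonneg (by positivity),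
    div_mul_cancel₀ _ hnorm.ne'] at hmem
  linarith [le_abs_self r]

theorem area_le_volume {C K : Set Plane} (hC : C.Nonempty) (hCK : C ⊆ K) (hK : Convex ℝ K)
    (hK' : IsCompact K) : area C ≤ volume.real K :=
  measureReal_mono (enclosedRegion_subset hC hCK hK hK'.isClosed) hK'.measure_lt_top.ne

theorem image_enclosedRegion (f : Plane ≃ᵃⁱ[ℝ] Plane) (C : Set Plane) :
    enclosedRegion (f '' C) = f '' enclosedRegion C := by
  have hcompl : (f '' C)ᶜ = f '' Cᶜ := (Set.image_compl_eq f.bijective).symm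
  have hcomponent {x : Plane} (hx : x ∈ Cᶜ) :
      connectedComponentIn (f '' Cᶜ) (f x) = f '' connectedComponentIn Cᶜ x :=
    (f.toHomeomorph.image_connectedComponentIn hx).symm
  have hbdd (s : Set Plane) : Bornology.IsBounded (f '' s) ↔ Bornology.IsBounded s :=
    ⟨fun h => (f.antilipschitz.isBounded_preimage h).subset (Set.subset_preimage_image f s),
      f.lipschitz.isBounded_image⟩
  rw [enclosedRegion, enclosedRegion, Set.image_union, hcompl]
  congr 1
  ext y
  constructor
  · rintro ⟨⟨x, hx, rfl⟩, h⟩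
    rw [hcomponent hx, hbdd] at h
    exact ⟨x, ⟨hx, h⟩, rfl⟩
  · rintro ⟨x, ⟨hx, h⟩, rfl⟩
    exact ⟨Set.mem_image_of_mem f hx, by rwa [hcomponent hx, hbdd]⟩

theorem volume_image_of_isometry {E F : Type*} [NormedAddCommGroup E] [InnerProductSpace ℝ E]
    [FiniteDimensional ℝ E] [MeasurableSpace E] [BorelSpace E] [NormedAddCommGroup F]
    [InnerProductSpace ℝ F] [FiniteDimensional ℝ F] [MeasurableSpace F] [BorelSpace F]
    (hrank : Module.finrank ℝ E = Module.finrank ℝ F) {f : E → F} (hf : Isometry f) (s : Set E) :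
    volume (f '' s) = volume s := by
  rw [← InnerProductSpace.euclideanHausdorffMeasure_eq_volume, ← hrank,
    hf.euclideanHausdorffMeasure_image, InnerProductSpace.euclideanHausdorffMeasure_eq_volume]

theorem AreCongruent.area_eq {C D : Set Plane} (h : AreCongruent C D) : area C = area D := by
  obtain ⟨f, rfl⟩ := h
  rw [area, area, image_enclosedRegion, measureReal_def, measureReal_def,
    volume_image_of_isometry rfl f.isometry]

end EnclosedRegion

section CongruentRegular

variable {m : ℕ} [NeZero m]

theorem closedLength_comp_neg {X : Type*} [PseudoMetricSpace X] (w : ZMod m → X) :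
    closedLength (fun k => w (-k)) = closedLength w := by
  rw [closedLength, closedLength,
    ← Equiv.sum_comp (Equiv.subLeft (-1 : ZMod m)) fun k => dist (w k) (w (k + 1))]
  refine sum_congr rfl fun k _ => ?_
  rw [Equiv.subLeft_apply, dist_comm]
  congr 2 <;> ring

theorem exists_isometry_regularVertices (c c' : ℂ) {b b' : ℂ} (hb : b ≠ 0) (h : ‖b‖ = ‖b'‖) :
    ∃ g : ℂ ≃ᵃⁱ[ℝ] ℂ, ∀ k : ZMod m, g (regularVertices c b k) = regularVertices c' b' k := by
  have hunit : b' / b ∈ Submonoid.unitSphere ℂ := by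
    rw [Submonoid.unitSphere, Submonoid.mem_mk, Subsemigroup.mem_mk, mem_sphere_zero_iff_norm,
      norm_div, ← h, div_self (norm_ne_zero_iff.2 hb)]
  let g : ℂ ≃ᵃⁱ[ℝ] ℂ := (rotation ⟨b' / b, hunit⟩).toAffineIsometryEquiv.trans
    (AffineIsometryEquiv.constVAdd ℝ ℂ (c' - b' / b * c))
  have hg (z : ℂ) : g z = c' - b' / b * c + b' / b * z := rfl
  refine ⟨g, fun k => ?_⟩
  rw [hg, regularVertices, regularVertices]
  field_simp
  ring

theorem exists_isometry_regularVertices_neg (c c' : ℂ) {b b' : ℂ} (hb : b ≠ 0) (h : ‖b‖ = ‖b'‖) :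
    ∃ g : ℂ ≃ᵃⁱ[ℝ] ℂ, ∀ k : ZMod m, g (regularVertices c b (-k)) = regularVertices c' b' k := by
  obtain ⟨g, hg⟩ := exists_isometry_regularVertices (m := m) (conj c) c'
    ((map_ne_zero conj).2 hb) ((Complex.norm_conj b).trans h)
  have hconj (k : ZMod m) :
      conj (regularVertices c b (-k)) = regularVertices (conj c) (conj b) k := by
    rw [regularVertices, regularVertices, AddChar.map_neg_eq_conj, map_add, map_mul,
      Complex.conj_conj]
  refine ⟨Complex.conjLIE.toAffineIsometryEquiv.trans g, fun k => ?_⟩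
  rw [← hg, ← hconj]
  rfl

theorem norm_eq_of_closedLength_regularVertices_eq (hm : 3 ≤ m) {c c' b b' : ℂ}
    (h : closedLength (regularVertices (m := m) c b) =
      closedLength (regularVertices (m := m) c' b')) : ‖b‖ = ‖b'‖ := by
  have : Fact (1 < m) := ⟨by omega⟩
  have hone : ‖(ZMod.stdAddChar (1 : ZMod m) : ℂ) - 1‖ ≠ 0 := by
    rw [norm_stdAddChar_sub_one]
    exact (mul_pos two_pos (sin_pi_mul_val_div_pos one_ne_zero)).ne'
  rw [closedLength_regularVertices, closedLength_regularVertices] at h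
  exact mul_right_cancel₀ hone (mul_left_cancel₀ (NeZero.ne (m : ℝ)) h)

end CongruentRegular

section Polygon

open MeasureTheory

/-- The identification of the Euclidean plane with the complex numbers, in which the closed polygons
`ZMod m → ℂ` live. -/
def toComplex : Plane ≃ₗᵢ[ℝ] ℂ := Complex.orthonormalBasisOneI.repr.symm

variable {m : ℕ}

theorem areCongruent_boundary_of_map_vertices {M N : Polygon Plane m} (f : Plane ≃ᵃⁱ[ℝ] Plane)
    (h : ∀ i, f (M i) = N i) : AreCongruent (M.boundary ℝ) (N.boundary ℝ) := by
  refine ⟨f, ?_⟩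
  rw [Polygon.boundary, Polygon.boundary, Set.image_iUnion]
  refine Set.iUnion_congr fun i => ?_
  rw [Polygon.edgeSet, Polygon.edgeSet, ← h, ← h]
  exact affineSegment_image f.toAffineEquiv.toAffineMap (M i) (M (finRotate m i))

theorem boundary_subset_convexHull (M : Polygon Plane m) :
    M.boundary ℝ ⊆ convexHull ℝ (Set.range M.vertices) := by
  refine Set.iUnion_subset fun i => ?_
  rw [Polygon.edgeSet, affineSegment_eq_segment]
  exact segment_subset_convexHull (Set.mem_range_self _) (Set.mem_range_self _)

variable [NeZero m]

/-- The vertices of a polygon, as complex numbers cyclically indexed by `ZMod m`. -/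
def complexVertices (M : Polygon Plane m) (k : ZMod m) : ℂ := toComplex (M ⟨k.val, ZMod.val_lt k⟩)

theorem closedLength_complexVertices (M : Polygon Plane m) :
    closedLength (complexVertices M) = perimeter M := by
  obtain ⟨n, rfl⟩ := Nat.exists_eq_succ_of_ne_zero (NeZero.ne m)
  change ∑ i : Fin (n + 1), dist (toComplex (M i)) (toComplex (M (i + 1))) = _
  simp only [perimeter, toComplex.dist_map, finRotate_apply]

theorem range_complexVertices (M : Polygon Plane m) :
    Set.range (complexVertices M) = toComplex '' Set.range M.vertices := by
  obtain ⟨n, rfl⟩ := Nat.exists_eq_succ_of_ne_zero (NeZero.ne m)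
  exact Set.range_comp toComplex M.vertices

theorem polyArea_le_volume_convexHull (M : Polygon Plane m) :
    polyArea M ≤ volume.real (convexHull ℝ (Set.range (complexVertices M))) := by
  have hne : (M.boundary ℝ).Nonempty := ⟨_, Set.mem_iUnion.2 ⟨0, left_mem_affineSegment ℝ _ _⟩⟩
  have hhull : convexHull ℝ (Set.range (complexVertices M)) =
      toComplex '' convexHull ℝ (Set.range M.vertices) := by
    rw [range_complexVertices]
    exact (toComplex.toLinearEquiv.toLinearMap.image_convexHull _).symm
  rw [hhull, measureReal_def, volume_image_of_isometry (by simp) toComplex.isometry]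
  exact area_le_volume hne (boundary_subset_convexHull M) (convex_convexHull ℝ _)
    ((Set.finite_range _).isCompact_convexHull ℝ)

theorem four_mul_rho_mul_polyArea_le (hm : 3 ≤ m) (M : Polygon Plane m) :
    4 * rho m * polyArea M ≤ perimeter M ^ 2 := by
  have hρ := rho_pos hm
  calc 4 * rho m * polyArea M
      ≤ 4 * rho m * volume.real (convexHull ℝ (Set.range (complexVertices M))) := by
        gcongr
        exact polyArea_le_volume_convexHull M
    _ ≤ closedLength (complexVertices M) ^ 2 := four_mul_rho_mul_volume_convexHull_le hm _
    _ = perimeter M ^ 2 := by rw [closedLength_complexVertices]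

theorem complexVertices_regularPolygon :
    complexVertices (regularPolygon m) =
      regularVertices 0 ((1 / Real.cos (Real.pi / m) : ℝ) : ℂ) := by
  ext k
  have htoComplex (x y : ℝ) : toComplex !₂[x, y] = x + y * Complex.I := by simp [toComplex]
  have hangle : 2 * Real.pi * k.val / m = 2 * (Real.pi * k.val / m) := by ring
  rw [complexVertices, regularVertices, zero_add, regularPolygon, map_smul, htoComplex, hangle,
    Complex.real_smul, stdAddChar_eq_exp, mul_comm Complex.I, Complex.exp_mul_I,
    Complex.ofReal_cos, Complex.ofReal_sin]

theorem perimeter_regularPolygon (hm : 3 ≤ m) : perimeter (regularPolygon m) = 2 * rho m := by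
  have : Fact (1 < m) := ⟨by omega⟩
  have hcos := cos_pi_div_pos hm
  rw [← closedLength_complexVertices, complexVertices_regularPolygon, closedLength_regularVertices,
    norm_stdAddChar_sub_one, ZMod.val_one, Nat.cast_one, mul_one, Complex.norm_real,
    Real.norm_of_nonneg (by positivity), rho, Real.tan_eq_sin_div_cos]
  ring

theorem areCongruent_boundary_of_map_complexVertices {M N : Polygon Plane m} (g : ℂ ≃ᵃⁱ[ℝ] ℂ)
    (h : ∀ k, g (complexVertices M k) = complexVertices N k) :
    AreCongruent (M.boundary ℝ) (N.boundary ℝ) := by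
  refine areCongruent_boundary_of_map_vertices (toComplex.toAffineIsometryEquiv.trans
    (g.trans toComplex.symm.toAffineIsometryEquiv)) fun i => toComplex.injective ?_
  have hi (P : Polygon Plane m) : complexVertices P i.val = toComplex (P i) := by
    simp only [complexVertices, ZMod.val_cast_of_lt i.isLt, Fin.eta]
  rw [← hi, ← h, hi]
  exact toComplex.apply_symm_apply _

theorem areCongruent_regularPolygon_of_complexVertices_eq (hm : 3 ≤ m) {M : Polygon Plane m}
    {c b : ℂ} (hperimeter : perimeter M = 2 * rho m)
    (hM : complexVertices M = regularVertices c b ∨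
      complexVertices M = fun k => regularVertices c b (-k)) :
    AreCongruent (M.boundary ℝ) ((regularPolygon m).boundary ℝ) := by
  have hlength : closedLength (regularVertices (m := m) c b) = 2 * rho m := by
    rw [← hperimeter, ← closedLength_complexVertices]
    rcases hM with h | h
    · rw [h]
    · rw [h, closedLength_comp_neg]
  have hnorm : ‖b‖ = ‖((1 / Real.cos (Real.pi / m) : ℝ) : ℂ)‖ := by
    refine norm_eq_of_closedLength_regularVertices_eq hm (c' := 0) (hlength.trans ?_)
    rw [← perimeter_regularPolygon hm, ← closedLength_complexVertices,
      complexVertices_regularPolygon]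
  have hb : b ≠ 0 := by
    have hcos := cos_pi_div_pos hm
    rw [← norm_pos_iff, hnorm, norm_pos_iff, Complex.ofReal_ne_zero]
    positivity
  obtain ⟨g, hg⟩ : ∃ g : ℂ ≃ᵃⁱ[ℝ] ℂ, ∀ k,
      g (complexVertices M k) = complexVertices (regularPolygon m) k := by
    rw [complexVertices_regularPolygon]
    rcases hM with h | h <;> rw [h]
    · exact exists_isometry_regularVertices c 0 hb hnorm
    · exact exists_isometry_regularVertices_neg c 0 hb hnorm
  exact areCongruent_boundary_of_map_complexVertices g hg

theorem areCongruent_regularPolygon_of_eq_rho (hm : 3 ≤ m) {M : Polygon Plane m}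
    (hperimeter : perimeter M = 2 * rho m) (harea : polyArea M = rho m) :
    AreCongruent (M.boundary ℝ) ((regularPolygon m).boundary ℝ) := by
  have hρ := rho_pos hm
  have hlength : closedLength (complexVertices M) = 2 * rho m := by
    rw [closedLength_complexVertices, hperimeter]
  have hhull : 4 * rho m * volume.real (convexHull ℝ (Set.range (complexVertices M))) =
      closedLength (complexVertices M) ^ 2 := by
    refine (four_mul_rho_mul_volume_convexHull_le hm _).antisymm ?_
    calc closedLength (complexVertices M) ^ 2
        = 4 * rho m * polyArea M := by rw [hlength, harea]; ring
      _ ≤ 4 * rho m * volume.real (convexHull ℝ (Set.range (complexVertices M))) := by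
        gcongr
        exact polyArea_le_volume_convexHull M
  obtain ⟨c, b, hM⟩ := eq_regularVertices_of_volume_convexHull_eq hm
    (by rw [hlength]; positivity) hhull
  exact areCongruent_regularPolygon_of_complexVertices_eq hm hperimeter hM

theorem polyArea_regularPolygon_le (hm : 3 ≤ m) : polyArea (regularPolygon m) ≤ rho m := by
  have hρ := rho_pos hm
  have h := four_mul_rho_mul_polyArea_le hm (regularPolygon m)
  rw [perimeter_regularPolygon hm] at h
  refine le_of_mul_le_mul_left (h.trans_eq ?_) (by positivity : 0 < 4 * rho m)
  ring

end Polygon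

section UnitPolygon

variable {m : ℕ}

theorem IsUnitPolygon.perimeter_eq {M : Polygon Plane m} (h : IsUnitPolygon M) :
    perimeter M = 2 * polyArea M := by
  rw [h, semiperimeter, mul_div_cancel₀ _ two_ne_zero]

theorem IsUnitPolygon.fundamentalMeasure_eq {M : Polygon Plane m} (h : IsUnitPolygon M)
    (hpos : 0 < polyArea M) : fundamentalMeasure M = polyArea M := by
  have hscale : scale 1 M = M := by simp [scale]
  rw [fundamentalMeasure, canonicalUnit, ← h, div_self hpos.ne', hscale]

theorem IsUnitPolygon.rho_le_polyArea (hm : 3 ≤ m) {M : Polygon Plane m} (h : IsUnitPolygon M)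
    (hpos : 0 < polyArea M) : rho m ≤ polyArea M := by
  have : NeZero m := ⟨by omega⟩
  have hle := four_mul_rho_mul_polyArea_le hm M
  rw [h.perimeter_eq] at hle
  refine le_of_mul_le_mul_right ?_ (by positivity : 0 < 4 * polyArea M)
  linarith

theorem IsSimple.injective {M : Polygon Plane m} (h : IsSimple M) : Function.Injective M.vertices :=
  fun i j hij => (h i j 0 (by simp) 0 (by simp) (by simpa [Polygon.edgePath] using hij)).1

theorem IsSimple.perimeter_pos (hm : 2 ≤ m) {M : Polygon Plane m} (h : IsSimple M) :
    0 < perimeter M := by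
  obtain ⟨n, rfl⟩ := Nat.exists_eq_add_of_le' hm
  refine Finset.sum_pos (fun i _ => dist_pos.2 (h.injective.ne ?_)) univ_nonempty
  rw [finRotate_apply]
  simp

end UnitPolygon

end UnitShapes

end

open UnitShapes in
theorem corollary5p4_general {m : ℕ} (hm : 3 ≤ m) {M : Polygon Plane m}
    (hM : 0 < perimeter M) (hU : IsUnitPolygon M) :
    rho m ≤ fundamentalMeasure M ∧ (rho m = fundamentalMeasure M ↔
      AreCongruent (M.boundary ℝ) ((regularPolygon m).boundary ℝ)) := by
  have : NeZero m := ⟨by omega⟩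
  have hpos : 0 < polyArea M := by linarith [hU.perimeter_eq]
  have hle := hU.rho_le_polyArea hm hpos
  rw [hU.fundamentalMeasure_eq hpos]
  refine ⟨hle, fun heq => ?_, fun hcongr => hle.antisymm ?_⟩
  · exact areCongruent_regularPolygon_of_eq_rho hm (heq ▸ hU.perimeter_eq) heq.symm
  · calc polyArea M = polyArea (regularPolygon m) := hcongr.area_eq
      _ ≤ rho m := polyArea_regularPolygon_le hm

theorem corollary5p4 (m : ℕ) (hm : 3 ≤ m) (M : Polygon UnitShapes.Plane m)
    (hM : UnitShapes.IsSimple M) (hU : UnitShapes.IsUnitPolygon M) :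
    UnitShapes.rho m ≤ UnitShapes.fundamentalMeasure M ∧
      (UnitShapes.rho m = UnitShapes.fundamentalMeasure M ↔
        UnitShapes.AreCongruent (M.boundary ℝ) ((UnitShapes.regularPolygon m).boundary ℝ)) :=
  corollary5p4_general hm (hM.perimeter_pos (by omega)) hU
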